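/- Let $a>0$, let $\Omega=\mathbb R\times(-a,a)$, $E_1=(\pi/(4a))^2$ and $K(y)=e^{y_1^2/4}$. All function spaces are real; $L^2(\Omega,K)$ is the $L^2$-space over $\Omega$ with respect to the measure $K(y)\,dy$, with norm $\|\cdot\|_K$, and $H^1(\Omega,K)$ is the space of those $u\in L^2(\Omega,K)$ whose weak first derivatives belong to $L^2(\Omega,K)$. Put $$\Gamma_0^D=\mathbb R\times\{-a\},\qquad \Gamma_\pi^D=(-\infty,0)\times\{-a\}\,\cup\,(0,\infty)\times\{a\}.$$ For $\theta\in\{0,\pi\}$ and $s\ge 0$ let $T_\theta^s$ be the self-adjoint operator in $L^2(\Omega,K)$ associated with the closed quadratic form $$J_\theta^s[u]=\|\partial_1u\|_K^2+e^s\|\partial_2u\|_K^2-E_1e^s\|u\|_K^2-\tfrac14\|u\|_K^2,$$ whose domain consists of all $u\in H^1(\Omega,K)$ with $u=0$ on $\Gamma_\theta^D$ in the sense of traces, and let $\mu_\theta(s)$ be the lowest point of the spectrum of $T_\theta^s$. Proposition. For every $s\ge 0$ the spectra of $T_0^s$ and $T_\pi^s$ have a lowest point, and $$\mu_0(s)=\tfrac14,\qquad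 \mu_\pi(s)>\tfrac14 .$$ -/

import Mathlib

open MeasureTheory Filter Topology
open scoped ContDiff ENNReal

noncomputable section

namespace TwistedStrip

/-- The value of the angle `θ ∈ {0, π}` that distinguishes the two boundary value problems. -/
inductive Theta where
  | zero
  | pi

/-- The infinite strip `Ω = ℝ × (-a, a)`. -/
def strip (a : ℝ) : Set (ℝ × ℝ) := Set.univ ×ˢ Set.Ioo (-a) a

/-- The Dirichlet part of the boundary of the strip. -/
def dirichletBdry (a : ℝ) : Theta → Set (ℝ × ℝ)
  | .zero => Set.univ ×ˢ {-a}
  | .pi => Set.Iio 0 ×ˢ {-a} ∪ Set.Ioi 0 ×ˢ {a}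

/-- The weight `K(y) = exp (y₁² / 4)`. -/
def weight (y : ℝ × ℝ) : ℝ := Real.exp (y.1 ^ 2 / 4)

/-- The measure `K(y) dy` on the strip. -/
def weightedMeasure (a : ℝ) : Measure (ℝ × ℝ) :=
  (volume.restrict (strip a)).withDensity fun y => ENNReal.ofReal (weight y)

/-- The real Hilbert space `L²(Ω, K)`. -/
abbrev L2K (a : ℝ) := Lp ℝ 2 (weightedMeasure a)

/-- The measure `K dσ` on the boundary `ℝ × {-a} ∪ ℝ × {a}` of the strip (for `a > 0`), where `σ` is
the arc length. -/
def bdryMeasure (a : ℝ) : Measure (ℝ × ℝ) :=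
  (Measure.map (fun x : ℝ => (x, -a)) volume
    + Measure.map (fun x : ℝ => (x, a)) volume).withDensity fun y => ENNReal.ofReal (weight y)

/-- `w` is the weak derivative of `u` in `Ω` in the direction of the vector `e`. -/
def IsWeakDeriv (a : ℝ) (e : ℝ × ℝ) (u w : ℝ × ℝ → ℝ) : Prop :=
  ∀ φ : ℝ × ℝ → ℝ, ContDiff ℝ ∞ φ → HasCompactSupport φ → tsupport φ ⊆ strip a →
    ∫ y in strip a, u y * fderiv ℝ φ y e = -∫ y in strip a, w y * φ y

/-- `f n → g` in `L²(μ)`. -/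
def TendstoL2 (μ : Measure (ℝ × ℝ)) (f : ℕ → ℝ × ℝ → ℝ) (g : ℝ × ℝ → ℝ) : Prop :=
  Tendsto (fun n => eLpNorm (fun y => f n y - g y) 2 μ) atTop (𝓝 0)

/-- The function `u ∈ H¹(Ω, K)` with weak gradient `(p, q)` has the trace `g` on the part `Γ` of
the boundary: the trace map `H¹(Ω, K) → L²(Γ, K)` is the continuous extension, from the restrictions
to `Ω` of `C₀^∞(ℝ²)` (which are dense in `H¹(Ω, K)`), of the map that restricts a function to `Γ`. -/
def HasTrace (a : ℝ) (Γ : Set (ℝ × ℝ)) (u p q g : ℝ × ℝ → ℝ) : Prop :=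
  MemLp g 2 ((bdryMeasure a).restrict Γ) ∧
  ∃ φ : ℕ → ℝ × ℝ → ℝ, (∀ n, ContDiff ℝ ∞ (φ n) ∧ HasCompactSupport (φ n)) ∧
    TendstoL2 (weightedMeasure a) φ u ∧
    TendstoL2 (weightedMeasure a) (fun n y => fderiv ℝ (φ n) y (1, 0)) p ∧
    TendstoL2 (weightedMeasure a) (fun n y => fderiv ℝ (φ n) y (0, 1)) q ∧
    TendstoL2 ((bdryMeasure a).restrict Γ) φ g

/-! ### Elementary facts -/

lemma weight_pos (y : ℝ × ℝ) : 0 < weight y := Real.exp_pos _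

lemma one_le_weight (y : ℝ × ℝ) : 1 ≤ weight y := Real.one_le_exp (by positivity)

lemma continuous_weight : Continuous weight := by unfold weight; fun_prop

lemma isOpen_strip (a : ℝ) : IsOpen (strip a) := isOpen_univ.prod isOpen_Ioo

lemma restrict_le_weightedMeasure (a : ℝ) :
    volume.restrict (strip a) ≤ weightedMeasure a := by
  conv_lhs => rw [← withDensity_one (μ := volume.restrict (strip a))]
  refine withDensity_mono (Eventually.of_forall fun y => ?_)
  simpa using one_le_weight y

lemma weightedMeasure_ac (a : ℝ) : weightedMeasure a ≪ volume.restrict (strip a) :=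
  withDensity_absolutelyContinuous _ _

instance (a : ℝ) : IsLocallyFiniteMeasure (weightedMeasure a) :=
  IsLocallyFiniteMeasure.withDensity_ofReal continuous_weight

lemma memLp_restrict {a : ℝ} (u : L2K a) : MemLp u 2 (volume.restrict (strip a)) :=
  (Lp.memLp u).mono_measure (restrict_le_weightedMeasure a)

lemma ae_restrict {a : ℝ} {P : ℝ × ℝ → Prop} (h : ∀ᵐ y ∂weightedMeasure a, P y) :
    ∀ᵐ y ∂volume.restrict (strip a), P y :=
  (Measure.absolutelyContinuous_of_le (restrict_le_weightedMeasure a)).ae_le h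

lemma integrable_mul {a : ℝ} (u : L2K a) {ψ : ℝ × ℝ → ℝ} (hψ : Continuous ψ)
    (hc : HasCompactSupport ψ) : Integrable (fun y => u y * ψ y) (volume.restrict (strip a)) :=
  (memLp_restrict u).integrable_mul (hψ.memLp_of_hasCompactSupport (p := 2) hc)

lemma continuous_fderiv_dir {φ : ℝ × ℝ → ℝ} (h : ContDiff ℝ ∞ φ) (e : ℝ × ℝ) :
    Continuous fun y => fderiv ℝ φ y e :=
  (h.continuous_fderiv (by simp)).clm_apply continuous_const

lemma hasCompactSupport_fderiv_dir {φ : ℝ × ℝ → ℝ} (h : HasCompactSupport φ) (e : ℝ × ℝ) :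
    HasCompactSupport fun y => fderiv ℝ φ y e :=
  h.fderiv_apply ℝ e

lemma IsWeakDeriv.congr {a : ℝ} {e : ℝ × ℝ} {u w u' w' : ℝ × ℝ → ℝ}
    (h : IsWeakDeriv a e u w) (hu : u =ᵐ[weightedMeasure a] u')
    (hw : w =ᵐ[weightedMeasure a] w') : IsWeakDeriv a e u' w' := by
  intro φ h1 h2 h3
  have e1 : ∫ y in strip a, u y * fderiv ℝ φ y e = ∫ y in strip a, u' y * fderiv ℝ φ y e :=
    integral_congr_ae (by filter_upwards [ae_restrict hu] with y hy; rw [hy])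
  have e2 : ∫ y in strip a, w y * φ y = ∫ y in strip a, w' y * φ y :=
    integral_congr_ae (by filter_upwards [ae_restrict hw] with y hy; rw [hy])
  rw [← e1, ← e2]; exact h φ h1 h2 h3

lemma IsWeakDeriv.add {a : ℝ} {e : ℝ × ℝ} {u w u' w' : L2K a}
    (h : IsWeakDeriv a e u w) (h' : IsWeakDeriv a e u' w') :
    IsWeakDeriv a e (u + u' : L2K a) (w + w' : L2K a) := by
  refine IsWeakDeriv.congr (u := fun y => u y + u' y) (w := fun y => w y + w' y) ?_
    (Lp.coeFn_add u u').symm (Lp.coeFn_add w w').symm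
  intro φ h1 h2 h3
  have c := continuous_fderiv_dir h1 e
  have k := hasCompactSupport_fderiv_dir h2 e
  simp only [add_mul]
  rw [integral_add (integrable_mul u c k) (integrable_mul u' c k),
    integral_add (integrable_mul w h1.continuous h2) (integrable_mul w' h1.continuous h2),
    h φ h1 h2 h3, h' φ h1 h2 h3]
  ring

lemma IsWeakDeriv.smul {a : ℝ} {e : ℝ × ℝ} {u w : L2K a} (c : ℝ)
    (h : IsWeakDeriv a e u w) : IsWeakDeriv a e (c • u : L2K a) (c • w : L2K a) := by
  refine IsWeakDeriv.congr (u := fun y => c * u y) (w := fun y => c * w y) ?_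
    (Lp.coeFn_smul c u).symm (Lp.coeFn_smul c w).symm
  intro φ h1 h2 h3
  simp only [mul_assoc, integral_const_mul]
  rw [h φ h1 h2 h3]
  ring

lemma TendstoL2.congr {μ : Measure (ℝ × ℝ)} {f : ℕ → ℝ × ℝ → ℝ} {g g' : ℝ × ℝ → ℝ}
    (h : TendstoL2 μ f g) (hg : g =ᵐ[μ] g') : TendstoL2 μ f g' := by
  refine Tendsto.congr (fun n => eLpNorm_congr_ae ?_) h
  filter_upwards [hg] with y hy; rw [hy]

lemma TendstoL2.add {μ : Measure (ℝ × ℝ)} {f f' : ℕ → ℝ × ℝ → ℝ} {g g' : ℝ × ℝ → ℝ}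
    (h : TendstoL2 μ f g) (h' : TendstoL2 μ f' g')
    (hf : ∀ n, Continuous (f n)) (hf' : ∀ n, Continuous (f' n))
    (hg : AEStronglyMeasurable g μ) (hg' : AEStronglyMeasurable g' μ) :
    TendstoL2 μ (fun n y => f n y + f' n y) (fun y => g y + g' y) := by
  unfold TendstoL2 at *
  have hs := h.add h'
  rw [add_zero] at hs
  refine tendsto_of_tendsto_of_tendsto_of_le_of_le tendsto_const_nhds hs
    (fun n => zero_le) fun n => ?_
  have e : (fun y => f n y + f' n y - (g y + g' y))
      = (fun y => f n y - g y) + (fun y => f' n y - g' y) := by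
    ext y; simp only [Pi.add_apply]; ring
  simp only [e]
  exact eLpNorm_add_le ((hf n).aestronglyMeasurable.sub hg)
    ((hf' n).aestronglyMeasurable.sub hg') (by norm_num)

lemma TendstoL2.smul {μ : Measure (ℝ × ℝ)} {f : ℕ → ℝ × ℝ → ℝ} {g : ℝ × ℝ → ℝ}
    (c : ℝ) (h : TendstoL2 μ f g) :
    TendstoL2 μ (fun n y => c * f n y) (fun y => c * g y) := by
  unfold TendstoL2 at *
  have e : ∀ n, eLpNorm (fun y => c * f n y - c * g y) 2 μ
      = ‖c‖ₑ * eLpNorm (fun y => f n y - g y) 2 μ := fun n => by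
    rw [← eLpNorm_const_smul]
    congr 1
    ext y; simp only [Pi.smul_apply, smul_eq_mul]; ring
  simp only [e]
  simpa using ENNReal.Tendsto.const_mul (a := ‖c‖ₑ) h (Or.inr enorm_ne_top)

lemma HasTrace.add {a : ℝ} {Γ : Set (ℝ × ℝ)} {u p q u' p' q' : L2K a} {g g' : ℝ × ℝ → ℝ}
    (h : HasTrace a Γ u p q g) (h' : HasTrace a Γ u' p' q' g') :
    HasTrace a Γ (u + u' : L2K a) (p + p' : L2K a) (q + q' : L2K a) (fun y => g y + g' y) := by
  obtain ⟨hg, φ, hφ, h0, h1, h2, h3⟩ := h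
  obtain ⟨hg', φ', hφ', h0', h1', h2', h3'⟩ := h'
  have key : ∀ (n : ℕ) (e y : ℝ × ℝ), fderiv ℝ (fun y => φ n y + φ' n y) y e
      = fderiv ℝ (φ n) y e + fderiv ℝ (φ' n) y e := fun n e y => by
    rw [fderiv_fun_add ((hφ n).1.differentiable (by simp) y)
      ((hφ' n).1.differentiable (by simp) y)]; rfl
  refine ⟨hg.add hg', fun n y => φ n y + φ' n y,
    fun n => ⟨(hφ n).1.add (hφ' n).1, (hφ n).2.add (hφ' n).2⟩, ?_, ?_, ?_, ?_⟩
  · exact (h0.add h0' (fun n => (hφ n).1.continuous) (fun n => (hφ' n).1.continuous)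
      (Lp.aestronglyMeasurable u) (Lp.aestronglyMeasurable u')).congr (Lp.coeFn_add u u').symm
  · simp only [key]
    exact (h1.add h1' (fun n => continuous_fderiv_dir (hφ n).1 _)
      (fun n => continuous_fderiv_dir (hφ' n).1 _)
      (Lp.aestronglyMeasurable p) (Lp.aestronglyMeasurable p')).congr (Lp.coeFn_add p p').symm
  · simp only [key]
    exact (h2.add h2' (fun n => continuous_fderiv_dir (hφ n).1 _)
      (fun n => continuous_fderiv_dir (hφ' n).1 _)
      (Lp.aestronglyMeasurable q) (Lp.aestronglyMeasurable q')).congr (Lp.coeFn_add q q').symm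
  · exact h3.add h3' (fun n => (hφ n).1.continuous) (fun n => (hφ' n).1.continuous) hg.1 hg'.1

lemma HasTrace.smul {a : ℝ} {Γ : Set (ℝ × ℝ)} {u p q : L2K a} {g : ℝ × ℝ → ℝ} (c : ℝ)
    (h : HasTrace a Γ u p q g) :
    HasTrace a Γ (c • u : L2K a) (c • p : L2K a) (c • q : L2K a) (fun y => c * g y) := by
  obtain ⟨hg, φ, hφ, h0, h1, h2, h3⟩ := h
  have key : ∀ (n : ℕ) (e y : ℝ × ℝ), fderiv ℝ (fun y => c * φ n y) y e
      = c * fderiv ℝ (φ n) y e := fun n e y => by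
    rw [fderiv_const_mul ((hφ n).1.differentiable (by simp) y)]; rfl
  refine ⟨hg.const_mul c, fun n y => c * φ n y,
    fun n => ⟨contDiff_const.mul (hφ n).1, (hφ n).2.mul_left⟩, ?_, ?_, ?_, h3.smul c⟩
  · exact (h0.smul c).congr (Lp.coeFn_smul c u).symm
  · simp only [key]
    exact (h1.smul c).congr (Lp.coeFn_smul c p).symm
  · simp only [key]
    exact (h2.smul c).congr (Lp.coeFn_smul c q).symm

lemma memLp_weighted (a : ℝ) {φ : ℝ × ℝ → ℝ} (h : Continuous φ) (hc : HasCompactSupport φ) :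
    MemLp φ 2 (weightedMeasure a) :=
  h.memLp_of_hasCompactSupport hc

lemma measurableSet_dirichletBdry (a : ℝ) (θ : Theta) : MeasurableSet (dirichletBdry a θ) := by
  cases θ
  · exact MeasurableSet.univ.prod (measurableSet_singleton _)
  · exact (measurableSet_Iio.prod (measurableSet_singleton _)).union
      (measurableSet_Ioi.prod (measurableSet_singleton _))

/-! ### The form domain, the form and the operator -/

/-- The space `𝔇_θ(Ω, K)` of the functions `u ∈ H¹(Ω, K)` that vanish on the Dirichlet part of the
boundary. Its elements are recorded as triples `(u, ∂₁u, ∂₂u)`; the weak derivatives are determined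
by `u`. -/
def formDomain (a : ℝ) (θ : Theta) : Submodule ℝ (L2K a × L2K a × L2K a) where
  carrier := {U | IsWeakDeriv a (1, 0) U.1 U.2.1 ∧ IsWeakDeriv a (0, 1) U.1 U.2.2 ∧
    HasTrace a (dirichletBdry a θ) U.1 U.2.1 U.2.2 (fun _ => 0)}
  add_mem' := by
    rintro U V ⟨h1, h2, h3⟩ ⟨k1, k2, k3⟩
    exact ⟨h1.add k1, h2.add k2, by simpa using h3.add k3⟩
  zero_mem' := by
    have z : ((0 : L2K a) : ℝ × ℝ → ℝ) =ᵐ[weightedMeasure a] fun _ => 0 := Lp.coeFn_zero _ _ _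
    have d : ∀ e, IsWeakDeriv a e (0 : L2K a) (0 : L2K a) := fun e =>
      IsWeakDeriv.congr (u := fun _ => 0) (w := fun _ => 0) (by intro φ _ _ _; simp) z.symm z.symm
    refine ⟨d _, d _, MemLp.zero, fun _ _ => 0, fun _ => ⟨contDiff_const, HasCompactSupport.zero⟩,
      ?_, ?_, ?_, ?_⟩
    · exact TendstoL2.congr (g := fun _ => 0) (by simp [TendstoL2]) z.symm
    · exact TendstoL2.congr (g := fun _ => 0) (by simp [TendstoL2]) z.symm
    · exact TendstoL2.congr (g := fun _ => 0) (by simp [TendstoL2]) z.symm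
    · simp [TendstoL2]
  smul_mem' := by
    rintro c U ⟨h1, h2, h3⟩
    exact ⟨h1.smul c, h2.smul c, by simpa using h3.smul c⟩

/-- The number `E₁ = (π / (4a))²`. -/
def E1 (a : ℝ) : ℝ := (Real.pi / (4 * a)) ^ 2

/-- The bilinear form `J^s(U, V)` on triples `U = (u, ∂₁u, ∂₂u)`, `V = (v, ∂₁v, ∂₂v)`. -/
def form (a s : ℝ) (U V : L2K a × L2K a × L2K a) : ℝ :=
  inner ℝ U.2.1 V.2.1 + Real.exp s * inner ℝ U.2.2 V.2.2
    - E1 a * Real.exp s * inner ℝ U.1 V.1 - 1 / 4 * inner ℝ U.1 V.1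

/-- The graph of the operator associated with the form `J_θ^s`: the pairs `(u, f)` such that
`u ∈ 𝔇_θ(Ω, K)` and `J_θ^s(u, v) = (f, v)_K` for all `v ∈ 𝔇_θ(Ω, K)`. -/
def opGraph (a : ℝ) (θ : Theta) (s : ℝ) : Submodule ℝ (L2K a × L2K a) where
  carrier := {x | ∃ U ∈ formDomain a θ, U.1 = x.1 ∧
    ∀ V ∈ formDomain a θ, form a s U V = inner ℝ x.2 V.1}
  add_mem' := by
    rintro x y ⟨U, hU, hx, h⟩ ⟨V, hV, hy, k⟩
    refine ⟨U + V, (formDomain a θ).add_mem hU hV, by simp [hx, hy], fun W hW => ?_⟩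
    have h1 := h W hW
    have h2 := k W hW
    simp only [form, Prod.fst_add, Prod.snd_add, inner_add_left] at h1 h2 ⊢
    linarith
  zero_mem' := ⟨0, (formDomain a θ).zero_mem, rfl, fun W _ => by simp [form]⟩
  smul_mem' := by
    rintro c x ⟨U, hU, hx, h⟩
    refine ⟨c • U, (formDomain a θ).smul_mem c hU, by simp [hx], fun W hW => ?_⟩
    have h1 := h W hW
    simp only [form, Prod.smul_fst, Prod.smul_snd, real_inner_smul_left] at h1 ⊢
    rw [← h1]; ring

/-- The operator `T_θ^s` associated with the form `J_θ^s` in `L²(Ω, K)`. -/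
def op (a : ℝ) (θ : Theta) (s : ℝ) : L2K a →ₗ.[ℝ] L2K a := (opGraph a θ s).toLinearPMap

/-- A function `φ ∈ C₀^∞(Ω)`, with its gradient, belongs to the form domain. -/
lemma test_mem_formDomain (a : ℝ) (θ : Theta) {φ : ℝ × ℝ → ℝ} (h : ContDiff ℝ ∞ φ)
    (hc : HasCompactSupport φ) (hs : tsupport φ ⊆ strip a) :
    ((memLp_weighted a h.continuous hc).toLp φ,
      (memLp_weighted a (continuous_fderiv_dir h (1, 0))
        (hasCompactSupport_fderiv_dir hc (1, 0))).toLp _,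
      (memLp_weighted a (continuous_fderiv_dir h (0, 1))
        (hasCompactSupport_fderiv_dir hc (0, 1))).toLp _) ∈ formDomain a θ := by
  have d : ∀ e, IsWeakDeriv a e φ (fun y => fderiv ℝ φ y e) := by
    intro e ψ g gc gs
    have dφ : Differentiable ℝ φ := h.differentiable (by simp)
    have dψ : Differentiable ℝ ψ := g.differentiable (by simp)
    rw [setIntegral_eq_integral_of_forall_compl_eq_zero,
      setIntegral_eq_integral_of_forall_compl_eq_zero]
    · refine integral_mul_fderiv_eq_neg_fderiv_mul_of_integrable ?_ ?_ ?_ (fun y _ => dφ y) (fun y _ => dψ y)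
      · exact ((continuous_fderiv_dir h e).mul g.continuous).integrable_of_hasCompactSupport
          gc.mul_left
      · exact (h.continuous.mul (continuous_fderiv_dir g e)).integrable_of_hasCompactSupport
          hc.mul_right
      · exact (h.continuous.mul g.continuous).integrable_of_hasCompactSupport hc.mul_right
    · intro y hy
      rw [image_eq_zero_of_notMem_tsupport fun k => hy (gs k), mul_zero]
    · intro y hy
      rw [image_eq_zero_of_notMem_tsupport fun k => hy (hs k), zero_mul]
  have z : ∀ {f : ℝ × ℝ → ℝ} (hf : MemLp f 2 (weightedMeasure a)),
      TendstoL2 (weightedMeasure a) (fun _ => f) (hf.toLp f) := fun {f} hf =>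
    TendstoL2.congr (g := f) (by simp [TendstoL2]) hf.coeFn_toLp.symm
  have m0 := memLp_weighted a h.continuous hc
  have m1 := fun e => memLp_weighted a (continuous_fderiv_dir h e)
    (hasCompactSupport_fderiv_dir hc e)
  refine ⟨(d _).congr m0.coeFn_toLp.symm (m1 _).coeFn_toLp.symm,
    (d _).congr m0.coeFn_toLp.symm (m1 _).coeFn_toLp.symm,
    MemLp.zero, fun _ => φ, fun _ => ⟨h, hc⟩, z m0, z (m1 _), z (m1 _), ?_⟩
  have e : (fun y => φ y - 0) =ᵐ[(bdryMeasure a).restrict (dirichletBdry a θ)] 0 := by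
    refine (ae_restrict_iff' (measurableSet_dirichletBdry a θ)).2 (Eventually.of_forall ?_)
    intro y hy
    have hy2 : y ∉ strip a := by
      intro k
      have k2 := k.2
      simp only [Set.mem_Ioo] at k2
      cases θ
      · have := hy.2
        simp only [Set.mem_singleton_iff] at this
        linarith
      · rcases hy with hy | hy
        · have := hy.2
          simp only [Set.mem_singleton_iff] at this
          linarith
        · have := hy.2
          simp only [Set.mem_singleton_iff] at this
          linarith
    simp [image_eq_zero_of_notMem_tsupport fun k => hy2 (hs k)]
  unfold TendstoL2
  simp only [eLpNorm_congr_ae e, eLpNorm_zero]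
  exact tendsto_const_nhds

/-- An element of `L²(Ω, K)` that integrates to zero against all test functions is zero. -/
lemma eq_zero_of_test {a : ℝ} (f : L2K a) {c : ℝ × ℝ → ℝ} (hc : Continuous c)
    (hc0 : ∀ y, c y ≠ 0)
    (h : ∀ φ : ℝ × ℝ → ℝ, ContDiff ℝ ∞ φ → HasCompactSupport φ → tsupport φ ⊆ strip a →
      ∫ y in strip a, f y * (c y * φ y) = 0) : f = 0 := by
  have hl : LocallyIntegrable (fun y => c y * f y) (volume.restrict (strip a)) := by
    simpa using ((memLp_restrict f).locallyIntegrable (by norm_num)).continuous_smul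
      (f := fun y => f y) hc
  have := (isOpen_strip a).ae_eq_zero_of_integral_contDiff_smul_eq_zero
    (hl.locallyIntegrableOn (strip a)) fun g g1 g2 g3 => by
      rw [← h g g1 g2 g3]
      refine integral_congr_ae (Eventually.of_forall fun y => ?_)
      simp only [smul_eq_mul]; ring
  rw [Lp.eq_zero_iff_ae_eq_zero]
  refine (weightedMeasure_ac a).ae_le ?_
  filter_upwards [this, ae_restrict_mem (isOpen_strip a).measurableSet] with y hy hy'
  simpa [hc0 y] using hy hy'

/-- The weak derivative is unique. -/
lemma weakDeriv_zero {a : ℝ} {e : ℝ × ℝ} {w : L2K a} (h : IsWeakDeriv a e (0 : L2K a) w) :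
    w = 0 := by
  refine eq_zero_of_test w (c := fun _ => 1) continuous_const (by simp) fun φ h1 h2 h3 => ?_
  have z : ((0 : L2K a) : ℝ × ℝ → ℝ) =ᵐ[weightedMeasure a] fun _ => 0 := Lp.coeFn_zero _ _ _
  have := h.congr z (ae_eq_refl _) φ h1 h2 h3
  simpa using this.symm

lemma inner_eq {a : ℝ} (f g : L2K a) :
    inner ℝ f g = ∫ y in strip a, f y * (weight y * g y) := by
  have hI : ∀ F : ℝ × ℝ → ℝ, ∫ y, F y ∂weightedMeasure a
      = ∫ y in strip a, (ENNReal.ofReal (weight y)).toReal • F y :=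
    integral_withDensity_eq_integral_toReal_smul continuous_weight.measurable.ennreal_ofReal
      (Eventually.of_forall fun _ => ENNReal.ofReal_lt_top)
  rw [L2.inner_def, hI]
  · refine integral_congr_ae (Eventually.of_forall fun y => ?_)
    simp only [ENNReal.toReal_ofReal (weight_pos y).le, smul_eq_mul]
    change weight y * (g y * f y) = _
    ring

/-- The form determines `T_θ^s u` uniquely, so that `opGraph` is the graph of an operator. -/
lemma opGraph_single_valued (a : ℝ) (θ : Theta) (s : ℝ) :
    ∀ x ∈ opGraph a θ s, x.1 = 0 → x.2 = 0 := by
  rintro x ⟨⟨u, p, q⟩, hU, hx, h⟩ h0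
  obtain rfl : u = 0 := hx.trans h0
  obtain rfl : p = 0 := weakDeriv_zero hU.1
  obtain rfl : q = 0 := weakDeriv_zero hU.2.1
  refine eq_zero_of_test x.2 continuous_weight (fun y => (weight_pos y).ne') fun φ h1 h2 h3 => ?_
  have := h _ (test_mem_formDomain a θ h1 h2 h3)
  simp only [form, inner_zero_left, inner_eq, mul_zero, add_zero, sub_zero] at this
  rw [this]
  refine integral_congr_ae ?_
  filter_upwards [ae_restrict (memLp_weighted a h1.continuous h2).coeFn_toLp] with y hy
  rw [hy]

lemma op_graph (a : ℝ) (θ : Theta) (s : ℝ) : (op a θ s).graph = opGraph a θ s :=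
  Submodule.toLinearPMap_graph_eq _ fun x hx h => opGraph_single_valued a θ s x hx h

/-- The spectrum of an unbounded operator `T`: the complement of the set of those `r` for which
`T - r` is a bijection from the domain of `T` to the whole space with a bounded inverse `R`. -/
def spec {E : Type*} [NormedAddCommGroup E] [NormedSpace ℝ E] (T : E →ₗ.[ℝ] E) : Set ℝ :=
  {r | ¬ ∃ R : E →L[ℝ] E, (∀ f : E, ∃ x : T.domain, (x : E) = R f ∧ T x - r • (x : E) = f) ∧
    ∀ x : T.domain, R (T x - r • (x : E)) = x}

/-- The lowest point `μ_θ(s)` of the spectrum of `T_θ^s`. -/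
def mu (a : ℝ) (θ : Theta) (s : ℝ) : ℝ := sInf (spec (op a θ s))

end TwistedStrip

end

/-!
The lowest point of the spectrum of the operator associated with a closed form that is bounded
below is the infimum of the Rayleigh quotient (`isLeast_spec`): below the infimum the Lax–Milgram
theorem gives the resolvent, and a bounded inverse at the infimum would keep the Rayleigh quotient
away from it. The form domain is complete because a vanishing trace survives limits in the norm of
`H¹(Ω, K)`. So the claim is about Rayleigh quotients, and lower bounds need to be proved only for
functions in `C₀^∞(ℝ²)`, with an error term on the Dirichlet part of the boundary that tends
to zero along the approximations in the definition of the trace (`form_lower_bound_of_test`).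

All lower bounds come from one-dimensional Riccati inequalities (`sub_le_integral_of_riccati`).

* Longitudinally, `∫ K φ' ^ 2 ≥ 1/2 ∫ K φ ^ 2` on the line, with equality for `exp (-y₁² / 4)`.
  The odd part of `φ` vanishes at `0` and satisfies the inequality with a larger constant, so that
  a multiple of `∫ K (φ(y₁) - φ(-y₁)) ^ 2` can be added on the right (`longitudinal_ineq`).
* Transversely, a Dirichlet condition at one end of `(-a, a)` gives the lowest eigenvalue `E₁`.

For `θ = 0` the two bounds give `J ≥ (1/2 - 1/4) ‖u‖ ^ 2`, and truncations of
`exp (-y₁² / 4) sin (π (y₂ + a) / (4 a))` show that `1/4` is the infimum.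

For `θ = π` the sections `f = φ(y₁, ·)` and `g = φ(-y₁, ·)`, `y₁ > 0`, satisfy Dirichlet conditions
at opposite ends. Their transverse ground states are not proportional, hence the term
`η ∫ (f - g) ^ 2` left over from the longitudinal inequality raises the lowest eigenvalue of the pair
strictly above `E₁` (`exists_transverse_pair_ineq`). This is quantitative: lowering the logarithmic
derivative of each ground state by `ε` times the distance to its Neumann end changes the two
potentials by functions of order `ε` whose sum is positive, and for `ε` small compared with `η` the
coupling lets the larger potential compensate the smaller one. No compactness is needed.
-/

noncomputable section

namespace TwistedStrip

/-! ### The lowest point of the spectrum of an operator associated with a form -/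

section FormSpectrum

variable {H V : Type*} [NormedAddCommGroup H] [InnerProductSpace ℝ H]
  [NormedAddCommGroup V] [InnerProductSpace ℝ V]

/-- The inner product of a real inner product space as a bounded bilinear form. -/
def innerForm (H : Type*) [NormedAddCommGroup H] [InnerProductSpace ℝ H] : H →L[ℝ] H →L[ℝ] ℝ :=
  innerSL ℝ

@[simp] lemma innerForm_apply (x y : H) : innerForm H x y = inner ℝ x y := rfl

/-- The form `B(U, W) - r (j U, j W)`. -/
def shiftedForm (j : V →L[ℝ] H) (B : V →L[ℝ] V →L[ℝ] ℝ) (r : ℝ) : V →L[ℝ] V →L[ℝ] ℝ :=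
  B - r • (innerForm H).bilinearComp j j

lemma shiftedForm_apply (j : V →L[ℝ] H) (B : V →L[ℝ] V →L[ℝ] ℝ) (r : ℝ) (U W : V) :
    shiftedForm j B r U W = B U W - r * inner ℝ (j U) (j W) := by
  simp [shiftedForm]

/-- Below the lower bound `m` of the form, Gårding's inequality upgrades the strict lower bound
in `H` to coercivity in the norm of the form domain. -/
lemma isCoercive_shiftedForm {j : V →L[ℝ] H} {B : V →L[ℝ] V →L[ℝ] ℝ} {α C m r : ℝ} (hα : 0 < α)
    (hG : ∀ U, α * ‖U‖ ^ 2 ≤ B U U + C * ‖j U‖ ^ 2) (hm : ∀ U, m * ‖j U‖ ^ 2 ≤ B U U)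
    (hr : r < m) : IsCoercive (shiftedForm j B r) := by
  -- In `(1 - d) (B - r) + d (B - r)`, the first part is bounded below by `hm` and the second by
  -- `hG`; with this `d` the terms in `‖j U‖ ^ 2` have a nonnegative sum.
  set M := |C + r|
  set d := (m - r) / ((m - r) + M) with hd
  have hM : 0 ≤ M := abs_nonneg _
  have hs : 0 < (m - r) + M := by linarith
  have hd0 : 0 < d := div_pos (by linarith) hs
  have hd1 : d ≤ 1 := (div_le_one hs).2 (by linarith)
  have hdM : (1 - d) * (m - r) = d * M := by rw [hd]; field_simp; ring
  refine ⟨d * α, mul_pos hd0 hα, fun U => ?_⟩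
  rw [shiftedForm_apply, real_inner_self_eq_norm_sq]
  have h1 := mul_le_mul_of_nonneg_left (hm U) (sub_nonneg.2 hd1)
  have h2 := mul_le_mul_of_nonneg_left (hG U) hd0.le
  have h3 : d * (C + r) * ‖j U‖ ^ 2 ≤ d * M * ‖j U‖ ^ 2 := by
    gcongr; exact le_abs_self _
  rw [← hdM] at h3
  nlinarith

variable {j : V →L[ℝ] H} {B : V →L[ℝ] V →L[ℝ] ℝ} {T : H →ₗ.[ℝ] H}

/-- A number below the lower bound of the form is in the resolvent set: the resolvent is given by
the Lax–Milgram theorem. -/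
lemma notMem_spec_of_lt [CompleteSpace H] [CompleteSpace V]
    (hT : ∀ x, x ∈ T.graph ↔ ∃ U, j U = x.1 ∧ ∀ W, B U W = inner ℝ x.2 (j W))
    {α C m r : ℝ} (hα : 0 < α) (hG : ∀ U, α * ‖U‖ ^ 2 ≤ B U U + C * ‖j U‖ ^ 2)
    (hm : ∀ U, m * ‖j U‖ ^ 2 ≤ B U U) (hr : r < m) : r ∉ spec T := by
  have hc := isCoercive_shiftedForm hα hG hm hr
  set L := hc.continuousLinearEquivOfBilin
  have hL : ∀ U W, inner ℝ (L U) W = B U W - r * inner ℝ (j U) (j W) := fun U W => by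
    rw [hc.continuousLinearEquivOfBilin_apply, shiftedForm_apply]
  have hj : ∀ f W, inner ℝ (j.adjoint f) W = inner ℝ f (j W) := fun f W =>
    j.adjoint_inner_left W f
  refine not_not.2 ⟨(j ∘L (L.symm : V →L[ℝ] V)) ∘L j.adjoint, fun f => ?_, fun x => ?_⟩
  · set U := L.symm (j.adjoint f) with hU
    have hmem : (j U, f + r • j U) ∈ T.graph := (hT _).2 ⟨U, rfl, fun W => by
      have := hL U W
      rw [hU, L.apply_symm_apply, hj, ← hU] at this
      rw [inner_add_left, real_inner_smul_left]
      linarith⟩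
    obtain ⟨x, hx, hx'⟩ := T.mem_graph_iff.1 hmem
    refine ⟨x, hx, ?_⟩
    simp only at hx hx'
    rw [hx', hx, add_sub_cancel_right]
  · obtain ⟨U, hU, h⟩ := (hT _).1 (T.mem_graph x)
    simp only at hU h
    have : j.adjoint (T x - r • (x : H)) = L U := ext_inner_right ℝ fun W => by
      rw [hj, hL, h, inner_sub_left, real_inner_smul_left, hU]
    simp [this, hU]

/-- The infimum `m` of the Rayleigh quotient is in the spectrum: a bounded inverse `R` of `T - m`
would give `‖j U‖ ^ 2 ≤ (‖R‖ + 1) (B(U, U) - m ‖j U‖ ^ 2)`. -/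
lemma mem_spec_of_rayleigh
    (hT : ∀ x, x ∈ T.graph ↔ ∃ U, j U = x.1 ∧ ∀ W, B U W = inner ℝ x.2 (j W))
    (hB : ∀ U W, B U W = B W U) {m : ℝ} (hm : ∀ U, m * ‖j U‖ ^ 2 ≤ B U U)
    (hm' : ∀ ε > 0, ∃ U, B U U < (m + ε) * ‖j U‖ ^ 2) : m ∈ spec T := by
  rintro ⟨R, hR, -⟩
  have hpos : 0 < ‖R‖ + 1 := by positivity
  obtain ⟨v, hv⟩ := hm' (1 / (‖R‖ + 1)) (by positivity)
  obtain ⟨x, hx, hx'⟩ := hR (j v)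
  obtain ⟨U, hU, h⟩ := (hT _).1 (T.mem_graph x)
  simp only at hU h
  have hTx : T x = j v + m • j U := by rw [← hx', hU]; abel
  have hBU : ∀ W, B U W = inner ℝ (j v) (j W) + m * inner ℝ (j U) (j W) := fun W => by
    rw [h, hTx, inner_add_left, real_inner_smul_left]
  -- nonnegativity of the form `B - m` at `v - t U`
  set t := 1 / (‖R‖ + 1) with ht
  have key := hm (v - t • U)
  have e1 : B (v - t • U) (v - t • U) = B v v - 2 * t * B U v + t ^ 2 * B U U := by
    simp only [map_sub, map_smul, sub_apply, smul_apply, smul_eq_mul, hB v U]; ring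
  have e2 : ‖j (v - t • U)‖ ^ 2
      = ‖j v‖ ^ 2 - 2 * t * inner ℝ (j v) (j U) + t ^ 2 * ‖j U‖ ^ 2 := by
    rw [map_sub, map_smul, norm_sub_sq_real, real_inner_smul_right, norm_smul, mul_pow,
      Real.norm_eq_abs, sq_abs]; ring
  rw [e1, e2, hBU, hBU, real_inner_self_eq_norm_sq, real_inner_self_eq_norm_sq,
    real_inner_comm (j v) (j U)] at key
  have hUn : inner ℝ (j v) (j U) ≤ ‖R‖ * ‖j v‖ ^ 2 := by
    calc inner ℝ (j v) (j U) ≤ ‖j v‖ * ‖j U‖ := real_inner_le_norm _ _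
      _ ≤ ‖j v‖ * (‖R‖ * ‖j v‖) := by
        gcongr; rw [hU, hx]; exact R.le_opNorm _
      _ = _ := by ring
  have htR : t * (‖R‖ + 1) = 1 := by rw [ht]; field_simp
  have ht0 : 0 < t := by positivity
  have h5 : t ^ 2 * inner ℝ (j v) (j U) ≤ t ^ 2 * (‖R‖ * ‖j v‖ ^ 2) := by gcongr
  have h6 : t ^ 2 * (‖R‖ * ‖j v‖ ^ 2) = t * ‖j v‖ ^ 2 - t ^ 2 * ‖j v‖ ^ 2 := by
    linear_combination t * ‖j v‖ ^ 2 * htR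
  nlinarith [mul_nonneg (sq_nonneg t) (sq_nonneg ‖j v‖)]

/-- The lowest point of the spectrum of the operator associated with a form that is bounded below
is the infimum of the Rayleigh quotient. -/
theorem isLeast_spec [CompleteSpace H] [CompleteSpace V]
    (hT : ∀ x, x ∈ T.graph ↔ ∃ U, j U = x.1 ∧ ∀ W, B U W = inner ℝ x.2 (j W))
    (hB : ∀ U W, B U W = B W U) {α C m : ℝ} (hα : 0 < α)
    (hG : ∀ U, α * ‖U‖ ^ 2 ≤ B U U + C * ‖j U‖ ^ 2)
    (hm : ∀ U, m * ‖j U‖ ^ 2 ≤ B U U)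
    (hm' : ∀ ε > 0, ∃ U, B U U < (m + ε) * ‖j U‖ ^ 2) : IsLeast (spec T) m :=
  ⟨mem_spec_of_rayleigh hT hB hm hm', fun _ hr => not_lt.1 fun hlt =>
    notMem_spec_of_lt hT hα hG hm hlt hr⟩

/-- If the form domain is not trivial in `H`, the spectrum has a lowest point. It is at least every
lower bound of the form. -/
theorem exists_isLeast_spec [CompleteSpace H] [CompleteSpace V]
    (hT : ∀ x, x ∈ T.graph ↔ ∃ U, j U = x.1 ∧ ∀ W, B U W = inner ℝ x.2 (j W))
    (hB : ∀ U W, B U W = B W U) {α C : ℝ} (hα : 0 < α)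
    (hG : ∀ U, α * ‖U‖ ^ 2 ≤ B U U + C * ‖j U‖ ^ 2) (hj : ∃ U, j U ≠ 0) :
    ∃ m, IsLeast (spec T) m ∧ ∀ m', (∀ U, m' * ‖j U‖ ^ 2 ≤ B U U) → m' ≤ m := by
  set S := {q : ℝ | ∃ U, j U ≠ 0 ∧ q = B U U / ‖j U‖ ^ 2} with hS
  have hne : S.Nonempty := let ⟨U, hU⟩ := hj; ⟨_, U, hU, rfl⟩
  have hlow : ∀ m', (∀ U, m' * ‖j U‖ ^ 2 ≤ B U U) → m' ∈ lowerBounds S := by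
    rintro m' h q ⟨U, hU, rfl⟩
    rw [le_div_iff₀ (by positivity)]
    exact h U
  have hbdd : BddBelow S := ⟨-C, hlow _ fun U => by
    nlinarith [hG U, mul_nonneg hα.le (sq_nonneg ‖U‖)]⟩
  refine ⟨sInf S, isLeast_spec hT hB hα hG (fun U => ?_) (fun ε hε => ?_),
    fun m' h => le_csInf hne fun q hq => hlow m' h hq⟩
  · rcases eq_or_ne (j U) 0 with h0 | h0
    · have := hG U
      rw [h0] at this ⊢
      simp only [norm_zero] at this ⊢
      nlinarith [mul_nonneg hα.le (sq_nonneg ‖U‖)]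
    · rw [← le_div_iff₀ (by positivity)]
      exact csInf_le hbdd ⟨U, h0, rfl⟩
  · obtain ⟨q, ⟨U, hU, rfl⟩, hq⟩ := exists_lt_of_csInf_lt hne (lt_add_of_pos_right (sInf S) hε)
    exact ⟨U, (div_lt_iff₀ (by positivity)).1 hq⟩

end FormSpectrum

/-! ### The form domain as a Hilbert space -/

/-- The vanishing trace can be tested one tolerance at a time. -/
lemma hasTrace_zero_iff {a : ℝ} {Γ : Set (ℝ × ℝ)} {u p q : ℝ × ℝ → ℝ} :
    HasTrace a Γ u p q (fun _ => 0) ↔ ∀ ε : ℝ≥0∞, ε ≠ 0 → ∃ φ : ℝ × ℝ → ℝ,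
      ContDiff ℝ ∞ φ ∧ HasCompactSupport φ ∧
      eLpNorm (fun y => φ y - u y) 2 (weightedMeasure a) ≤ ε ∧
      eLpNorm (fun y => fderiv ℝ φ y (1, 0) - p y) 2 (weightedMeasure a) ≤ ε ∧
      eLpNorm (fun y => fderiv ℝ φ y (0, 1) - q y) 2 (weightedMeasure a) ≤ ε ∧
      eLpNorm (fun y => φ y - 0) 2 ((bdryMeasure a).restrict Γ) ≤ ε := by
  constructor
  · rintro ⟨-, φ, hφ, h0, h1, h2, h3⟩ ε hε
    have hp := pos_iff_ne_zero.2 hε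
    obtain ⟨n, k0, k1, k2, k3⟩ := ((ENNReal.tendsto_nhds_zero.1 h0 ε hp).and
      ((ENNReal.tendsto_nhds_zero.1 h1 ε hp).and ((ENNReal.tendsto_nhds_zero.1 h2 ε hp).and
        (ENNReal.tendsto_nhds_zero.1 h3 ε hp)))).exists
    exact ⟨φ n, (hφ n).1, (hφ n).2, k0, k1, k2, k3⟩
  · intro h
    choose φ hs hc h0 h1 h2 h3 using fun n : ℕ => h ((n : ℝ≥0∞)⁻¹) (by simp)
    have key : ∀ f : ℕ → ℝ≥0∞, (∀ n, f n ≤ (n : ℝ≥0∞)⁻¹) → Tendsto f atTop (𝓝 0) := fun f hf =>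
      tendsto_of_tendsto_of_tendsto_of_le_of_le tendsto_const_nhds
        ENNReal.tendsto_inv_nat_nhds_zero (fun _ => zero_le) hf
    exact ⟨MemLp.zero, φ, fun n => ⟨hs n, hc n⟩, key _ h0, key _ h1, key _ h2, key _ h3⟩

/-- Integration over the strip against a test function is continuous on `L²(Ω, K)`. -/
lemma continuous_setIntegral_mul (a : ℝ) {ψ : ℝ × ℝ → ℝ} (h : Continuous ψ)
    (hc : HasCompactSupport ψ) : Continuous fun u : L2K a => ∫ y in strip a, u y * ψ y := by
  have h' : Continuous fun y => (weight y)⁻¹ * ψ y :=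
    (continuous_weight.inv₀ fun y => (weight_pos y).ne').mul h
  have hm := memLp_weighted a h' hc.mul_left
  have : (fun u : L2K a => ∫ y in strip a, u y * ψ y) = fun u : L2K a => inner ℝ u (hm.toLp _) := by
    ext u
    rw [inner_eq]
    refine integral_congr_ae ?_
    filter_upwards [ae_restrict hm.coeFn_toLp] with y hy
    rw [hy, mul_inv_cancel_left₀ (weight_pos y).ne']
  rw [this]
  exact continuous_id.inner continuous_const

lemma isClosed_isWeakDeriv (a : ℝ) (e : ℝ × ℝ) :
    IsClosed {x : L2K a × L2K a | IsWeakDeriv a e x.1 x.2} := by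
  simp only [IsWeakDeriv, Set.ofPred_forall]
  refine isClosed_iInter fun φ => isClosed_iInter fun h1 => isClosed_iInter fun h2 =>
    isClosed_iInter fun _ => isClosed_eq ?_ ?_
  · exact (continuous_setIntegral_mul a (continuous_fderiv_dir h1 e)
      (hasCompactSupport_fderiv_dir h2 e)).comp continuous_fst
  · exact ((continuous_setIntegral_mul a h1.continuous h2).comp continuous_snd).neg

lemma eLpNorm_sub_le {a : ℝ} {f : ℝ × ℝ → ℝ} (hf : Continuous f) {u v : L2K a} {ε : ℝ≥0∞}
    (h : eLpNorm (fun y => f y - u y) 2 (weightedMeasure a) ≤ ε / 2)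
    (h' : edist u v ≤ ε / 2) : eLpNorm (fun y => f y - v y) 2 (weightedMeasure a) ≤ ε := by
  rw [Lp.edist_def] at h'
  have e : (fun y => f y - v y) = (fun y => f y - u y) + (⇑u - ⇑v) := by
    ext y; simp
  rw [e]
  calc _ ≤ eLpNorm (fun y => f y - u y) 2 (weightedMeasure a)
        + eLpNorm (⇑u - ⇑v) 2 (weightedMeasure a) :=
      eLpNorm_add_le (hf.aestronglyMeasurable.sub (Lp.aestronglyMeasurable u))
        ((Lp.aestronglyMeasurable u).sub (Lp.aestronglyMeasurable v)) (by norm_num)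
    _ ≤ ε / 2 + ε / 2 := add_le_add h h'
    _ = ε := ENNReal.add_halves ε

lemma isClosed_hasTrace_zero (a : ℝ) (Γ : Set (ℝ × ℝ)) :
    IsClosed {U : L2K a × L2K a × L2K a | HasTrace a Γ U.1 U.2.1 U.2.2 (fun _ => 0)} := by
  refine isClosed_of_closure_subset fun U hU => hasTrace_zero_iff.2 fun ε hε => ?_
  have hε2 : ε / 2 ≠ 0 := by simpa using hε
  obtain ⟨W, hW, hd⟩ := EMetric.mem_closure_iff.1 hU (ε / 2) (pos_iff_ne_zero.2 hε2)
  obtain ⟨φ, hs, hc, h0, h1, h2, h3⟩ := hasTrace_zero_iff.1 hW (ε / 2) hε2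
  rw [edist_comm, Prod.edist_eq, Prod.edist_eq] at hd
  obtain ⟨d0, d1, d2⟩ : edist W.1 U.1 ≤ ε / 2 ∧ edist W.2.1 U.2.1 ≤ ε / 2 ∧
      edist W.2.2 U.2.2 ≤ ε / 2 := by
    simpa only [max_le_iff] using hd.le
  exact ⟨φ, hs, hc, eLpNorm_sub_le hs.continuous h0 d0,
    eLpNorm_sub_le (continuous_fderiv_dir hs _) h1 d1,
    eLpNorm_sub_le (continuous_fderiv_dir hs _) h2 d2, h3.trans ENNReal.half_le_self⟩

lemma isClosed_formDomain (a : ℝ) (θ : Theta) :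
    IsClosed (formDomain a θ : Set (L2K a × L2K a × L2K a)) :=
  ((isClosed_isWeakDeriv a (1, 0)).preimage
      (f := fun U : L2K a × L2K a × L2K a => (U.1, U.2.1)) (by fun_prop)).inter
    (((isClosed_isWeakDeriv a (0, 1)).preimage
      (f := fun U : L2K a × L2K a × L2K a => (U.1, U.2.2)) (by fun_prop)).inter
      (isClosed_hasTrace_zero a _))

/-- The Hilbert space of triples `(u, p, q)` of functions in `L²(Ω, K)`. -/
abbrev TripleSpace (a : ℝ) := PiLp 2 fun _ : Fin 3 => L2K a

/-- The coordinates of a triple in `TripleSpace`. -/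
def tripleCoords (a : ℝ) : TripleSpace a →L[ℝ] L2K a × L2K a × L2K a :=
  (PiLp.proj 2 _ 0).prod ((PiLp.proj 2 _ 1).prod (PiLp.proj 2 _ 2))

/-- The form domain, with the inner product of `H¹(Ω, K)`. -/
def formSpace (a : ℝ) (θ : Theta) : Submodule ℝ (TripleSpace a) :=
  (formDomain a θ).comap (tripleCoords a : TripleSpace a →ₗ[ℝ] L2K a × L2K a × L2K a)

instance (a : ℝ) (θ : Theta) : CompleteSpace (formSpace a θ) :=
  ((isClosed_formDomain a θ).preimage (tripleCoords a).continuous).completeSpace_coe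

/-- The embedding `(u, ∂₁u, ∂₂u) ↦ u` of the form domain into `L²(Ω, K)`. -/
def formEmb (a : ℝ) (θ : Theta) : formSpace a θ →L[ℝ] L2K a :=
  (PiLp.proj 2 (fun _ : Fin 3 => L2K a) 0) ∘L (formSpace a θ).subtypeL

/-- The form `J_θ^s` as a bounded bilinear form on the form domain. -/
def formCLM (a : ℝ) (θ : Theta) (s : ℝ) : formSpace a θ →L[ℝ] formSpace a θ →L[ℝ] ℝ :=
  let P (i : Fin 3) : formSpace a θ →L[ℝ] L2K a :=
    (PiLp.proj 2 (fun _ : Fin 3 => L2K a) i) ∘L (formSpace a θ).subtypeL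
  (innerForm (L2K a)).bilinearComp (P 1) (P 1)
    + Real.exp s • (innerForm (L2K a)).bilinearComp (P 2) (P 2)
    - (E1 a * Real.exp s) • (innerForm (L2K a)).bilinearComp (P 0) (P 0)
    - (1 / 4 : ℝ) • (innerForm (L2K a)).bilinearComp (P 0) (P 0)

lemma formCLM_apply (a : ℝ) (θ : Theta) (s : ℝ) (U W : formSpace a θ) :
    formCLM a θ s U W = form a s (tripleCoords a U) (tripleCoords a W) := by
  simp [formCLM, form, tripleCoords]

lemma formEmb_apply (a : ℝ) (θ : Theta) (U : formSpace a θ) :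
    formEmb a θ U = (tripleCoords a U).1 := rfl

/-- The element of the Hilbert space `formSpace` with given coordinates. -/
def formSpaceMk {a : ℝ} {θ : Theta} (U : L2K a × L2K a × L2K a) (hU : U ∈ formDomain a θ) :
    formSpace a θ :=
  ⟨WithLp.toLp 2 ![U.1, U.2.1, U.2.2], by simpa [formSpace, tripleCoords] using hU⟩

lemma tripleCoords_mk {a : ℝ} {θ : Theta} (U : L2K a × L2K a × L2K a)
    (hU : U ∈ formDomain a θ) : tripleCoords a (formSpaceMk U hU) = U := by
  simp [tripleCoords, formSpaceMk]

lemma mem_graph_op_iff (a : ℝ) (θ : Theta) (s : ℝ) (x : L2K a × L2K a) :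
    x ∈ (op a θ s).graph ↔ ∃ U, formEmb a θ U = x.1 ∧
      ∀ W, formCLM a θ s U W = inner ℝ x.2 (formEmb a θ W) := by
  rw [op_graph]
  constructor
  · rintro ⟨U, hU, hx, h⟩
    refine ⟨formSpaceMk U hU, ?_, fun W => ?_⟩
    · rw [formEmb_apply, tripleCoords_mk, hx]
    · rw [formCLM_apply, tripleCoords_mk, formEmb_apply]
      exact h _ W.2
  · rintro ⟨U, hx, h⟩
    refine ⟨tripleCoords a U, U.2, hx, fun W hW => ?_⟩
    have := h (formSpaceMk W hW)
    rwa [formCLM_apply, tripleCoords_mk, formEmb_apply, tripleCoords_mk] at this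

lemma formCLM_symm (a : ℝ) (θ : Theta) (s : ℝ) (U W : formSpace a θ) :
    formCLM a θ s U W = formCLM a θ s W U := by
  simp only [formCLM_apply, form, real_inner_comm]

lemma formCLM_garding (a : ℝ) (θ : Theta) (s : ℝ) (U : formSpace a θ) :
    min 1 (Real.exp s) * ‖U‖ ^ 2 ≤
      formCLM a θ s U U + (1 + E1 a * Real.exp s + 1 / 4) * ‖formEmb a θ U‖ ^ 2 := by
  have hn : ‖U‖ ^ 2 = ‖(tripleCoords a U).1‖ ^ 2 + ‖(tripleCoords a U).2.1‖ ^ 2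
      + ‖(tripleCoords a U).2.2‖ ^ 2 := by
    rw [Submodule.coe_norm, PiLp.norm_sq_eq_of_L2, Fin.sum_univ_three]; rfl
  rw [formCLM_apply, formEmb_apply, hn]
  simp only [form, real_inner_self_eq_norm_sq]
  have h1 := mul_le_mul_of_nonneg_right (min_le_left 1 (Real.exp s))
    (sq_nonneg ‖(tripleCoords a U).1‖)
  have h2 := mul_le_mul_of_nonneg_right (min_le_left 1 (Real.exp s))
    (sq_nonneg ‖(tripleCoords a U).2.1‖)
  have h3 := mul_le_mul_of_nonneg_right (min_le_right 1 (Real.exp s))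
    (sq_nonneg ‖(tripleCoords a U).2.2‖)
  linarith

/-! ### One-dimensional Hardy-type inequalities -/

/-- If the flux `m` satisfies the Riccati inequality `m' + m ^ 2 / w ≤ -q`, then
`w ψ' ^ 2 - q ψ ^ 2 ≥ (m ψ ^ 2)'`, by completing the square. -/
lemma sub_le_integral_of_riccati {l r : ℝ} (hlr : l ≤ r) {w q m m' ψ ψ' : ℝ → ℝ}
    (hw : ContinuousOn w (Set.Icc l r)) (hq : ContinuousOn q (Set.Icc l r))
    (hm : ∀ x ∈ Set.Icc l r, HasDerivAt m (m' x) x) (hψ : ∀ x, HasDerivAt ψ (ψ' x) x)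
    (hψ' : Continuous ψ') (hpos : ∀ x ∈ Set.Icc l r, 0 < w x)
    (hric : ∀ x ∈ Set.Icc l r, m' x + m x ^ 2 / w x ≤ -q x) :
    m r * ψ r ^ 2 - m l * ψ l ^ 2 ≤ ∫ x in l..r, (w x * ψ' x ^ 2 - q x * ψ x ^ 2) := by
  have hc : Continuous ψ := continuous_iff_continuousAt.2 fun x => (hψ x).continuousAt
  have hd : ∀ x ∈ Set.Icc l r, HasDerivAt (fun x => m x * ψ x ^ 2)
      (m' x * ψ x ^ 2 + m x * (2 * ψ x * ψ' x)) x := fun x hx =>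
    ((hm x hx).mul ((hψ x).pow 2)).congr_deriv (by simp)
  refine intervalIntegral.sub_le_integral_of_hasDeriv_right_of_le hlr
    (fun x hx => (hd x hx).continuousAt.continuousWithinAt)
    (fun x hx => (hd x (Set.Ioo_subset_Icc_self hx)).hasDerivWithinAt) ?_ ?_
  · exact ContinuousOn.integrableOn_Icc
      ((hw.mul (hψ'.pow 2).continuousOn).sub (hq.mul (hc.pow 2).continuousOn))
  · intro x hx
    have hx' := Set.Ioo_subset_Icc_self hx
    have hp := hpos x hx'
    have h1 := mul_le_mul_of_nonneg_right (hric x hx') (sq_nonneg (ψ x))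
    have h2 : 0 ≤ w x * (ψ' x - m x / w x * ψ x) ^ 2 := by positivity
    have h3 : w x * (ψ' x - m x / w x * ψ x) ^ 2
        = w x * ψ' x ^ 2 - 2 * m x * ψ x * ψ' x + m x ^ 2 / w x * ψ x ^ 2 := by
      field_simp; ring
    nlinarith

/-- The half-line version, for the weight `exp (y ^ 2 / 4)`, with the flux written as
`exp (y ^ 2 / 4) c(y)`. -/
lemma integral_Ioi_nonneg_of_riccati {c c' ψ ψ' : ℝ → ℝ} {lam : ℝ}
    (hc : ∀ x, 0 ≤ x → HasDerivAt c (c' x) x) (hψ : ∀ x, HasDerivAt ψ (ψ' x) x)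
    (hψ' : Continuous ψ') (hs : HasCompactSupport ψ)
    (hric : ∀ x, 0 ≤ x → c' x + c x ^ 2 + x / 2 * c x ≤ -lam) (h0 : c 0 * ψ 0 ^ 2 = 0) :
    0 ≤ ∫ x in Set.Ioi 0, Real.exp (x ^ 2 / 4) * (ψ' x ^ 2 - lam * ψ x ^ 2) := by
  obtain ⟨R, hR, hsupp⟩ : ∃ R : ℝ, 0 < R ∧ ∀ x, R ≤ x → ψ x = 0 ∧ ψ' x = 0 := by
    obtain ⟨R, hR⟩ := hs.isCompact.isBounded.subset_closedBall 0
    refine ⟨max R 0 + 1, by positivity, fun x hx => ?_⟩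
    have hx' : x ∉ tsupport ψ := fun h => by
      have := hR h
      rw [mem_closedBall_zero_iff, Real.norm_eq_abs] at this
      have := le_abs_self x
      have := le_max_left R 0
      linarith
    refine ⟨image_eq_zero_of_notMem_tsupport hx', ?_⟩
    rw [← (hψ x).deriv]
    exact image_eq_zero_of_notMem_tsupport fun h => hx' (tsupport_deriv_subset h)
  have hK : ∀ x : ℝ, HasDerivAt (fun x => Real.exp (x ^ 2 / 4))
      (Real.exp (x ^ 2 / 4) * (x / 2)) x := fun x => by
    have := ((hasDerivAt_pow 2 x).div_const 4).exp
    convert this using 1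
    norm_num; ring
  have key := sub_le_integral_of_riccati (w := fun x => Real.exp (x ^ 2 / 4))
    (q := fun x => lam * Real.exp (x ^ 2 / 4)) (m := fun x => Real.exp (x ^ 2 / 4) * c x)
    hR.le (by fun_prop) (by fun_prop) (fun x hx => (hK x).mul (hc x hx.1)) hψ hψ'
    (fun x _ => Real.exp_pos _) fun x hx => by
      have := mul_le_mul_of_nonneg_left (hric x hx.1) (Real.exp_pos (x ^ 2 / 4)).le
      have e : (Real.exp (x ^ 2 / 4) * c x) ^ 2 / Real.exp (x ^ 2 / 4)
          = Real.exp (x ^ 2 / 4) * c x ^ 2 := by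
        field_simp
      rw [e]
      linarith
  have hb : Real.exp (0 ^ 2 / 4) * c 0 * ψ 0 ^ 2 = 0 := by rw [mul_assoc, h0, mul_zero]
  rw [(hsupp R le_rfl).1, hb, intervalIntegral.integral_of_le hR.le] at key
  have e : ∫ x in Set.Ioi 0, Real.exp (x ^ 2 / 4) * (ψ' x ^ 2 - lam * ψ x ^ 2)
      = ∫ x in Set.Ioc 0 R, Real.exp (x ^ 2 / 4) * (ψ' x ^ 2 - lam * ψ x ^ 2) := by
    refine setIntegral_eq_of_subset_of_forall_sdiff_eq_zero measurableSet_Ioi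
      Set.Ioc_subset_Ioi_self fun x hx => ?_
    have hx2 : R ≤ x := by
      by_contra h
      exact hx.2 ⟨hx.1, (not_le.1 h).le⟩
    simp [hsupp x hx2]
  rw [e]
  refine le_trans (by simp) (key.trans_eq (integral_congr_ae (Eventually.of_forall fun x => ?_)))
  simp only; ring

/-- On the half-line, the even part of a function satisfies the inequality with the constant `1/2`
of the whole line, and the odd part, which vanishes at `0`, with a larger constant. -/
lemma longitudinal_ineq {φ φ' : ℝ → ℝ} (hφ : ∀ x, HasDerivAt φ (φ' x) x) (hφ' : Continuous φ')
    (hs : HasCompactSupport φ) :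
    0 ≤ ∫ x in Set.Ioi 0, Real.exp (x ^ 2 / 4) * (φ' x ^ 2 + φ' (-x) ^ 2
      - 1 / 2 * (φ x ^ 2 + φ (-x) ^ 2) - 3 / 32 * (φ x - φ (-x)) ^ 2) := by
  have hneg : ∀ x, HasDerivAt (fun x => φ (-x)) (-φ' (-x)) x := fun x => by
    have := (hφ (-x)).comp x (hasDerivAt_neg x)
    simpa [Function.comp_def] using this
  have hc : Continuous φ := continuous_iff_continuousAt.2 fun x => (hφ x).continuousAt
  have hsn : HasCompactSupport fun x => φ (-x) := hs.comp_homeomorph (Homeomorph.neg ℝ)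
  have hs' : HasCompactSupport φ' := by
    rw [show φ' = deriv φ from funext fun x => (hφ x).deriv.symm]; exact hs.deriv
  have hsn' : HasCompactSupport fun x => φ' (-x) := hs'.comp_homeomorph (Homeomorph.neg ℝ)
  have he := integral_Ioi_nonneg_of_riccati (c := fun x => -x / 2) (c' := fun _ => -1 / 2)
    (lam := 1 / 2) (fun x _ => (hasDerivAt_neg x).div_const 2) (ψ := fun x => φ x + φ (-x))
    (fun x => (hφ x).add (hneg x))
    (by fun_prop) (hs.add hsn) (fun x _ => by ring_nf; rfl) (by simp)
  have ho := integral_Ioi_nonneg_of_riccati (c := fun x => 1 / 2 * (1 + x)⁻¹ + -x / 2)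
    (c' := fun x => 1 / 2 * (-1 / (1 + x) ^ 2) + -1 / 2)
    (lam := 1 / 2 + 3 / 16)
    (fun x hx => (HasDerivAt.const_mul (1 / 2)
      (((hasDerivAt_id x).const_add 1).inv (by simp; linarith))).add
        ((hasDerivAt_neg x).div_const 2))
    (ψ := fun x => φ x - φ (-x)) (fun x => (hφ x).sub (hneg x))
    (by fun_prop) (hs.sub hsn) (fun x hx => ?_) (by simp)
  · have h2 := mul_nonneg (by norm_num : (0 : ℝ) ≤ 1 / 2) (add_nonneg he ho)
    rw [← integral_add, ← integral_const_mul] at h2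
    · refine h2.trans_eq (integral_congr_ae (Eventually.of_forall fun x => ?_))
      simp only; ring
    · refine (Continuous.integrable_of_hasCompactSupport (by fun_prop) ?_).integrableOn
      refine HasCompactSupport.mul_left (HasCompactSupport.sub ?_ ?_)
      · simp only [pow_two]; exact ((hs'.add hsn'.neg).mul_left)
      · simp only [pow_two]; exact ((hs.add hsn).mul_left).mul_left
    · refine (Continuous.integrable_of_hasCompactSupport (by fun_prop) ?_).integrableOn
      refine HasCompactSupport.mul_left (HasCompactSupport.sub ?_ ?_)
      · simp only [pow_two]; exact ((hs'.sub hsn'.neg).mul_left)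
      · simp only [pow_two]; exact ((hs.sub hsn).mul_left).mul_left
  · have h1 : 0 < 1 + x := by linarith
    rw [← sub_nonneg]
    have : -(1 / 2 + 3 / 16) - (1 / 2 * (-1 / (1 + x) ^ 2) + -1 / 2
        + (1 / 2 * (1 + x)⁻¹ + -x / 2) ^ 2 + x / 2 * (1 / 2 * (1 + x)⁻¹ + -x / 2))
        = (1 - x) ^ 2 / (16 * (1 + x) ^ 2) := by
      field_simp; ring
    rw [this]; positivity

/-- The Riccati inequality for a Dirichlet condition at `-a` and a Neumann condition at `a`. The
flux is the logarithmic derivative `k tan (k (a - y))` of `cos (k (a - y))`, which for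
`k = π / (4 a)` is the ground state, lowered by the perturbation `ε (a - y)`. As `2 a k < π / 2`,
it is finite at `-a`, so that functions with `ψ (-a) ≠ 0` can be admitted at the price of a
boundary term. -/
lemma transverse_ineq_perturbed {a k : ℝ} (ha : 0 < a) (hk : 0 < k)
    (hak : 2 * a * k < Real.pi / 2) (ε : ℝ) {ψ ψ' : ℝ → ℝ} (hψ : ∀ x, HasDerivAt ψ (ψ' x) x)
    (hψ' : Continuous ψ') :
    0 ≤ (∫ x in (-a)..a, (ψ' x ^ 2 - (k ^ 2 - ε + 2 * ε * (a - x) * k * Real.tan (k * (a - x))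
      - ε ^ 2 * (a - x) ^ 2) * ψ x ^ 2))
      + (k * Real.tan (k * (2 * a)) - ε * (2 * a)) * ψ (-a) ^ 2 := by
  have hcos : ∀ x ∈ Set.Icc (-a) a, 0 < Real.cos (k * (a - x)) := fun x hx => by
    have h1 : 0 ≤ k * (a - x) := mul_nonneg hk.le (by linarith [hx.2])
    have h2 : k * (a - x) ≤ k * (2 * a) := mul_le_mul_of_nonneg_left (by linarith [hx.1]) hk.le
    exact Real.cos_pos_of_mem_Ioo ⟨by linarith [Real.pi_pos], by linarith⟩
  have hlin : ∀ x : ℝ, HasDerivAt (fun x => k * (a - x)) (-k) x := fun x => by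
    simpa using ((hasDerivAt_id x).const_sub a).const_mul k
  have htan : ∀ x ∈ Set.Icc (-a) a, HasDerivAt (fun x => Real.tan (k * (a - x)))
      (1 / Real.cos (k * (a - x)) ^ 2 * (-k)) x := fun x hx =>
    (Real.hasDerivAt_tan (hcos x hx).ne').comp x (h := fun x => k * (a - x)) (hlin x)
  have hcont : ContinuousOn (fun x => Real.tan (k * (a - x))) (Set.Icc (-a) a) := fun x hx =>
    (htan x hx).continuousAt.continuousWithinAt
  have key := sub_le_integral_of_riccati (l := -a) (r := a) (w := fun _ => 1)
    (q := fun x => k ^ 2 - ε + 2 * ε * (a - x) * k * Real.tan (k * (a - x)) - ε ^ 2 * (a - x) ^ 2)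
    (m := fun x => k * Real.tan (k * (a - x)) - ε * (a - x))
    (by linarith) (by fun_prop) (by fun_prop)
    (fun x hx => ((htan x hx).const_mul k).sub
      (((hasDerivAt_id x).const_sub a).const_mul ε)) hψ hψ'
    (fun _ _ => one_pos) fun x hx => by
      have h1 : 1 / Real.cos (k * (a - x)) ^ 2 = 1 + Real.tan (k * (a - x)) ^ 2 := by
        rw [← Real.inv_one_add_tan_sq (hcos x hx).ne', one_div, inv_inv]
      rw [h1]
      refine le_of_eq ?_
      ring
  simp only [sub_self, mul_zero, Real.tan_zero, zero_mul, one_mul] at key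
  have e : a - -a = 2 * a := by ring
  rw [e] at key
  linarith

lemma transverse_ineq {a k : ℝ} (ha : 0 < a) (hk : 0 < k) (hak : 2 * a * k < Real.pi / 2)
    {ψ ψ' : ℝ → ℝ} (hψ : ∀ x, HasDerivAt ψ (ψ' x) x) (hψ' : Continuous ψ') :
    0 ≤ (∫ x in (-a)..a, (ψ' x ^ 2 - k ^ 2 * ψ x ^ 2))
      + k * Real.tan (k * (2 * a)) * ψ (-a) ^ 2 := by
  simpa using transverse_ineq_perturbed ha hk hak 0 hψ hψ'

/-- A coupling `η (f - g) ^ 2` with `η` much larger than `ε` absorbs one slightly negative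
coefficient, of the size `ε`, if the sum of the two coefficients is positive, of the size `ε`. -/
lemma quadratic_nonneg {ε η X Y f g : ℝ} (hε : 0 < ε) (hη : 20 * ε ≤ η) (hX : -(1.21 * ε) ≤ X)
    (hY : -(1.21 * ε) ≤ Y) (hXY : 0.18 * ε ≤ X + Y) :
    0 ≤ X * g ^ 2 + Y * f ^ 2 + η * (f - g) ^ 2 := by
  have key : ∀ {Z W p q : ℝ}, -(1.21 * ε) ≤ W → W < 0 → 0.18 * ε ≤ Z + W →
      0 ≤ Z * p ^ 2 + W * q ^ 2 + η * (q - p) ^ 2 := by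
    intro Z W p q h1 h2 h3
    have k1 : (0.18 * ε - W) * p ^ 2 ≤ Z * p ^ 2 :=
      mul_le_mul_of_nonneg_right (by linarith) (sq_nonneg p)
    have k2 : 20 * ε * (q - p) ^ 2 ≤ η * (q - p) ^ 2 :=
      mul_le_mul_of_nonneg_right hη (sq_nonneg _)
    nlinarith [mul_nonneg hε.le (sq_nonneg p), mul_nonneg hε.le (sq_nonneg (q - p)),
      mul_nonneg hε.le (sq_nonneg (p + 7 * (q - p))),
      mul_nonneg hε.le (sq_nonneg (p - 7 * (q - p)))]
  rcases lt_or_ge Y 0 with h | h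
  · exact key hY h hXY
  · rcases lt_or_ge X 0 with h' | h'
    · have := key (p := f) (q := g) hX h' (by linarith : 0.18 * ε ≤ Y + X)
      nlinarith
    · have : 0 ≤ η := by linarith
      positivity

lemma E1_pos {a : ℝ} (ha : 0 < a) : 0 < E1 a := by unfold E1; positivity

/-- The perturbation `ε` must be small compared with the coupling `η`, since the gain in the
potentials is of the order `ε` and the loss by the coupling of the order `ε ^ 2 / η`. -/
lemma exists_small_parameter {a η : ℝ} (ha : 0 < a) (hη : 0 < η) :
    ∃ ε : ℝ, 0 < ε ∧ 20 * ε ≤ η ∧ ε * (20 * (1 + 4 * a ^ 2)) ≤ 1 ∧ ε ^ 2 < E1 a := by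
  have hE := E1_pos ha
  have h : ∀ᶠ ε : ℝ in 𝓝[>] 0, 20 * ε < η ∧ ε * (20 * (1 + 4 * a ^ 2)) < 1 ∧ ε ^ 2 < E1 a := by
    refine nhdsWithin_le_nhds ?_
    refine (ContinuousAt.eventually_lt (by fun_prop) (by fun_prop) (by simpa)).and
      ((ContinuousAt.eventually_lt (by fun_prop) (by fun_prop) (by simp)).and
        (ContinuousAt.eventually_lt (by fun_prop) (by fun_prop) (by simpa)))
  obtain ⟨ε, ⟨h1, h2, h3⟩, h0⟩ := (h.and self_mem_nhdsWithin).exists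
  exact ⟨ε, h0, h1.le, h2.le, h3⟩

/-- The pointwise form of the coupled transverse inequality: `u` and `v` are the distances to the
two sides of the strip, `Q` and `R` the potentials obtained from the two perturbed ground states.
Each may be slightly below `E`, but not both. -/
lemma coupled_potential_nonneg {ε η E k u v Q R f g : ℝ} (hε : 0 < ε) (hη : 20 * ε ≤ η)
    (hεS : ε * (20 * (1 + (u + v) ^ 2)) ≤ 1) (hu : 0 ≤ u) (hv : 0 ≤ v) (hk : k ^ 2 = E - ε ^ 2)
    (hτ : 2.4 - (u + v) ^ 2 * ε ^ 2 ≤ ((u + v) * k) ^ 2)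
    (hQ : k ^ 2 - ε + 2 * ε * (k * u) ^ 2 - ε ^ 2 * u ^ 2 ≤ Q)
    (hR : k ^ 2 - ε + 2 * ε * (k * v) ^ 2 - ε ^ 2 * v ^ 2 ≤ R) :
    0 ≤ (Q - E - 0.01 * ε) * g ^ 2 + (R - E - 0.01 * ε) * f ^ 2 + η * (f - g) ^ 2 := by
  have huv : 0 ≤ u * v := mul_nonneg hu hv
  set S := (u + v) ^ 2 with hS
  have hS0 : 0 ≤ S := sq_nonneg _
  have s1 : ε ^ 2 + ε ^ 2 * S ≤ 0.05 * ε := by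
    have := mul_le_mul_of_nonneg_left hεS hε.le
    linarith
  have s2 : ε ^ 2 ≤ 0.05 * ε := by linarith [mul_nonneg (sq_nonneg ε) hS0]
  have hε1 : ε ≤ 0.05 := by
    rw [pow_two] at s2
    exact le_of_mul_le_mul_right s2 hε
  have s3 : ε ^ 2 * S * ε ≤ 0.05 * ε * ε :=
    mul_le_mul_of_nonneg_right (by linarith [sq_nonneg ε]) hε.le
  -- `Q + R ≥ 2 k ^ 2 + ε (((u + v) k) ^ 2 - 2) - ε ^ 2 S`, where `((u + v) k) ^ 2` is close to
  -- `π ^ 2 / 4 > 2`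
  have hsum : u ^ 2 + v ^ 2 ≤ S := by rw [hS]; linarith [add_sq u v]
  have c0 := mul_le_mul_of_nonneg_left hsum (sq_nonneg ε)
  have c1 : 0 ≤ ε ^ 2 * u ^ 2 := by positivity
  have c2 : 0 ≤ ε ^ 2 * v ^ 2 := by positivity
  have d1 : 0 ≤ 2 * ε * (k * u) ^ 2 := by positivity
  have d2 : 0 ≤ 2 * ε * (k * v) ^ 2 := by positivity
  have b : ((u + v) * k) ^ 2 ≤ 2 * ((k * u) ^ 2 + (k * v) ^ 2) := by
    linarith [sq_nonneg (k * u - k * v)]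
  have b' := mul_le_mul_of_nonneg_left (hτ.trans b) hε.le
  refine quadratic_nonneg hε hη (by linarith) (by linarith) (by linarith)

/-- A Dirichlet condition at `a` for `f`, at `-a` for `g`, and an arbitrarily weak coupling
`η (f - g) ^ 2` together raise the lowest transverse eigenvalue above `E₁`: the ground states
of the two boundary conditions are mirror images of each other and not proportional. -/
lemma exists_transverse_pair_ineq {a η : ℝ} (ha : 0 < a) (hη : 0 < η) :
    ∃ δ C : ℝ, 0 < δ ∧ ∀ f f' g g' : ℝ → ℝ, (∀ x, HasDerivAt f (f' x) x) → Continuous f' →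
      (∀ x, HasDerivAt g (g' x) x) → Continuous g' →
      0 ≤ (∫ x in (-a)..a, (f' x ^ 2 + g' x ^ 2 - (E1 a + δ) * (f x ^ 2 + g x ^ 2)
        + η * (f x - g x) ^ 2)) + C * (f a ^ 2 + g (-a) ^ 2) := by
  obtain ⟨ε, hε, hεη, hεa, hεE⟩ := exists_small_parameter ha hη
  -- `k` is close to `π / (4 a)`, with an error that is negligible compared with `ε`
  set k := Real.sqrt (E1 a - ε ^ 2) with hk
  have hk2 : k ^ 2 = E1 a - ε ^ 2 := Real.sq_sqrt (by linarith)
  have hk0 : 0 < k := Real.sqrt_pos.2 (by linarith)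
  have hkE : k < Real.pi / (4 * a) := by
    refine lt_of_pow_lt_pow_left₀ 2 (by positivity) ?_
    rw [hk2, E1]
    linarith [pow_pos hε 2]
  have hak : 2 * a * k < Real.pi / 2 := by
    rw [lt_div_iff₀ (by positivity)] at hkE
    linarith
  have hE : 4 * a ^ 2 * E1 a = Real.pi ^ 2 / 4 := by rw [E1]; field_simp
  have hτ : 2.4 - 4 * a ^ 2 * ε ^ 2 ≤ (2 * a * k) ^ 2 := by
    have h3 := Real.pi_gt_d2
    have : (2 * a * k) ^ 2 = 4 * a ^ 2 * E1 a - 4 * a ^ 2 * ε ^ 2 := by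
      rw [mul_pow, hk2]; ring
    rw [this, hE]
    nlinarith
  set q : ℝ → ℝ := fun x => k ^ 2 - ε + 2 * ε * (a - x) * k * Real.tan (k * (a - x))
    - ε ^ 2 * (a - x) ^ 2 with hq
  have htan : ∀ x ∈ Set.Ioc (-a) a, k * (a - x) ≤ Real.tan (k * (a - x)) := fun x hx =>
    Real.le_tan (mul_nonneg hk0.le (by linarith [hx.2]))
      (lt_of_le_of_lt (mul_le_mul_of_nonneg_left (by linarith [hx.1]) hk0.le)
        (by linarith : k * (2 * a) < Real.pi / 2))
  -- `tan t ≥ t` bounds the potential from below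
  have hq1 : ∀ x ∈ Set.Ioc (-a) a, k ^ 2 - ε + 2 * ε * (k * (a - x)) ^ 2 - ε ^ 2 * (a - x) ^ 2
      ≤ q x := fun x hx => by
    have h0 : 0 ≤ 2 * ε * (a - x) * k :=
      mul_nonneg (mul_nonneg (by positivity) (by linarith [hx.2])) hk0.le
    have := mul_le_mul_of_nonneg_left (htan x hx) h0
    simp only [hq]
    nlinarith
  refine ⟨0.01 * ε, k * Real.tan (k * (2 * a)) - ε * (2 * a), by positivity,
    fun f f' g g' hf hf' hg hg' => ?_⟩
  have hg1 := transverse_ineq_perturbed ha hk0 hak ε hg hg'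
  -- the inequality for `f` is the one for `g`, reflected
  have hf1 := transverse_ineq_perturbed ha hk0 hak ε (ψ := fun x => f (-x))
    (ψ' := fun x => -f' (-x))
    (fun x => by simpa [Function.comp_def] using (hf (-x)).comp x (hasDerivAt_neg x)) (by fun_prop)
  have hfr : ∫ x in (-a)..a, ((-f' (-x)) ^ 2 - q x * f (-x) ^ 2)
      = ∫ x in (-a)..a, (f' x ^ 2 - q (-x) * f x ^ 2) := by
    have := intervalIntegral.integral_comp_neg (a := -a) (b := a)
      fun x => f' x ^ 2 - q (-x) * f x ^ 2
    simp only [neg_neg] at this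
    rw [← this]
    simp only [neg_sq]
  rw [hfr, neg_neg] at hf1
  change 0 ≤ (∫ x in (-a)..a, (g' x ^ 2 - q x * g x ^ 2)) + _ at hg1
  have hfc : Continuous f := continuous_iff_continuousAt.2 fun x => (hf x).continuousAt
  have hgc : Continuous g := continuous_iff_continuousAt.2 fun x => (hg x).continuousAt
  have hqc : ContinuousOn q (Set.uIcc (-a) a) := by
    rw [Set.uIcc_of_le (by linarith)]
    have : ContinuousOn (fun x => Real.tan (k * (a - x))) (Set.Icc (-a) a) := by
      refine Real.continuousOn_tan.comp (by fun_prop) fun x hx => ?_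
      have h1 : 0 ≤ k * (a - x) := mul_nonneg hk0.le (by linarith [hx.2])
      have h2 : k * (a - x) ≤ k * (2 * a) := mul_le_mul_of_nonneg_left (by linarith [hx.1]) hk0.le
      exact (Real.cos_pos_of_mem_Ioo ⟨by linarith [Real.pi_pos], by linarith⟩).ne'
    fun_prop
  clear_value q
  have hqn : ContinuousOn (fun x => q (-x)) (Set.uIcc (-a) a) := by
    refine hqc.comp (by fun_prop) fun x hx => ?_
    rw [Set.uIcc_of_le (by linarith)] at hx ⊢
    exact ⟨by linarith [hx.2], by linarith [hx.1]⟩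
  have i1 : IntervalIntegrable (fun x => f' x ^ 2 - q (-x) * f x ^ 2) volume (-a) a :=
    ((hf'.pow 2).continuousOn.sub (hqn.mul (hfc.pow 2).continuousOn)).intervalIntegrable
  have i2 : IntervalIntegrable (fun x => g' x ^ 2 - q x * g x ^ 2) volume (-a) a :=
    ((hg'.pow 2).continuousOn.sub (hqc.mul (hgc.pow 2).continuousOn)).intervalIntegrable
  have hmono := intervalIntegral.integral_mono_on_of_le_Ioo (by linarith) (i1.add i2)
    (Continuous.intervalIntegrable (by fun_prop) (-a) a :
      IntervalIntegrable (fun x => f' x ^ 2 + g' x ^ 2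
        - (E1 a + 0.01 * ε) * (f x ^ 2 + g x ^ 2) + η * (f x - g x) ^ 2) volume (-a) a)
    fun x hx => ?_
  · rw [intervalIntegral.integral_add i1 i2] at hmono
    linarith
  · have k1 := hq1 x (Set.Ioo_subset_Ioc_self hx)
    have k2 := hq1 (-x) ⟨by linarith [hx.2], by linarith [hx.1]⟩
    have hs : a - x + (a - -x) = 2 * a := by ring
    have := coupled_potential_nonneg (u := a - x) (v := a - -x) (f := f x) (g := g x) hε hεη
      (by rw [hs, mul_pow]; norm_num; exact hεa) (by linarith [hx.2]) (by linarith [hx.1]) hk2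
      (by rw [hs]; linarith) k1 k2
    linarith

/-! ### Inequalities on the strip for test functions -/

/-- The half `(0, ∞) × (-a, a)` of the strip. -/
def halfStrip (a : ℝ) : Set (ℝ × ℝ) := Set.Ioi 0 ×ˢ Set.Ioo (-a) a

lemma setIntegral_prod_swapped {F : ℝ × ℝ → ℝ} (hF : Integrable F) (s t : Set ℝ) :
    ∫ z in s ×ˢ t, F z = ∫ y in t, ∫ x in s, F (x, y) := by
  rw [Measure.volume_eq_prod, ← setIntegral_prod_swap, setIntegral_prod]
  · rfl
  · exact (Integrable.swap (by rwa [← Measure.volume_eq_prod])).integrableOn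

lemma halfStrip_nonneg_of_longitudinal {a : ℝ} {F : ℝ × ℝ → ℝ} (hF : Integrable F)
    (h : ∀ y, 0 ≤ ∫ x in Set.Ioi 0, F (x, y)) : 0 ≤ ∫ z in halfStrip a, F z := by
  rw [halfStrip, setIntegral_prod_swapped hF]
  exact integral_nonneg h

lemma halfStrip_nonneg_of_transverse {a : ℝ} (ha : 0 < a) {F : ℝ × ℝ → ℝ} (hF : Integrable F)
    {b : ℝ → ℝ} (hb : Integrable b)
    (h : ∀ x, 0 ≤ (∫ y in (-a)..a, F (x, y)) + b x) :
    0 ≤ (∫ z in halfStrip a, F z) + ∫ x in Set.Ioi 0, b x := by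
  have hF' : Integrable F ((volume.restrict (Set.Ioi (0 : ℝ))).prod
      (volume.restrict (Set.Ioo (-a) a))) := by
    rw [Measure.prod_restrict, ← Measure.volume_eq_prod]; exact hF.integrableOn
  rw [halfStrip, Measure.volume_eq_prod, ← Measure.prod_restrict, integral_prod _ hF',
    ← integral_add hF'.integral_prod_left hb.integrableOn]
  refine integral_nonneg fun x => ?_
  have := h x
  rwa [intervalIntegral.integral_of_le (by linarith), integral_Ioc_eq_integral_Ioo] at this

lemma setIntegral_strip_eq {a : ℝ} {F : ℝ × ℝ → ℝ} (hF : Continuous F)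
    (hc : HasCompactSupport F) :
    ∫ z in strip a, F z = ∫ z in halfStrip a, (F z + F (-z.1, z.2)) := by
  have hrefl : HasCompactSupport fun z : ℝ × ℝ => F (-z.1, z.2) :=
    hc.comp_homeomorph ((Homeomorph.neg ℝ).prodCongr (Homeomorph.refl ℝ))
  have hi := (hF.integrable_of_hasCompactSupport hc).add
    (Continuous.integrable_of_hasCompactSupport (μ := volume) (by fun_prop) hrefl)
  rw [strip, halfStrip, setIntegral_prod_swapped (hF.integrable_of_hasCompactSupport hc)]
  refine Eq.trans ?_ (setIntegral_prod_swapped hi _ _).symm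
  refine integral_congr_ae (Eventually.of_forall fun y => ?_)
  have hcl : Topology.IsClosedEmbedding fun x : ℝ => (x, y) :=
    Topology.IsClosedEmbedding.of_continuous_injective_isClosedMap (by fun_prop)
      (fun x x' h => by simpa using h) (isClosedMap_prodMk_right y)
  have hy : Integrable fun x => F (x, y) :=
    Continuous.integrable_of_hasCompactSupport (by fun_prop) (hc.comp_isClosedEmbedding hcl)
  simp only [Measure.restrict_univ, Pi.add_apply]
  rw [integral_add hy.integrableOn hy.comp_neg.integrableOn,
    integral_comp_neg_Ioi 0 (fun x => F (x, y)), neg_zero, add_comm,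
    intervalIntegral.integral_Iic_add_Ioi hy.integrableOn hy.integrableOn]

/-- The square of the norm of `L²(Ω, K)`, as an integral. -/
def normSq (a : ℝ) (h : ℝ × ℝ → ℝ) : ℝ := ∫ y in strip a, weight y * h y ^ 2

/-- The integral of `K φ²` over the half-line that starts at `(0, c)` in the direction
`(σ, 0)`, where `σ = ±1`. -/
def halfLineSq (σ c : ℝ) (φ : ℝ × ℝ → ℝ) : ℝ :=
  ∫ x in Set.Ioi 0, Real.exp (x ^ 2 / 4) * φ (σ * x, c) ^ 2

lemma hasCompactSupport_horizontal {F : ℝ × ℝ → ℝ} (hc : HasCompactSupport F) (y : ℝ) :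
    HasCompactSupport fun x => F (x, y) :=
  hc.comp_isClosedEmbedding (Topology.IsClosedEmbedding.of_continuous_injective_isClosedMap
    (by fun_prop) (fun x x' h => by simpa using h) (isClosedMap_prodMk_right y))

lemma hasCompactSupport_reflect {F : ℝ × ℝ → ℝ} (hc : HasCompactSupport F) :
    HasCompactSupport fun z : ℝ × ℝ => F (-z.1, z.2) :=
  hc.comp_homeomorph ((Homeomorph.neg ℝ).prodCongr (Homeomorph.refl ℝ))

lemma normSq_eq {a : ℝ} {h : ℝ × ℝ → ℝ} (hh : Continuous h) (hc : HasCompactSupport h) :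
    normSq a h = ∫ z in halfStrip a, weight z * (h z ^ 2 + h (-z.1, z.2) ^ 2) := by
  have kw := continuous_weight
  refine (setIntegral_strip_eq (F := fun z => weight z * h z ^ 2) (by fun_prop) ?_).trans ?_
  · simp only [pow_two]
    exact hc.mul_left.mul_left
  · refine integral_congr_ae (Eventually.of_forall fun z => ?_)
    simp only [weight, neg_sq]; ring

lemma hasDerivAt_horizontal {φ : ℝ × ℝ → ℝ} (h : ContDiff ℝ ∞ φ) (x y : ℝ) :
    HasDerivAt (fun x => φ (x, y)) (fderiv ℝ φ (x, y) (1, 0)) x :=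
  (h.differentiable (by simp) (x, y)).hasFDerivAt.comp_hasDerivAt x
    ((hasDerivAt_id x).prodMk (hasDerivAt_const x y))

lemma hasDerivAt_vertical {φ : ℝ × ℝ → ℝ} (h : ContDiff ℝ ∞ φ) (x y : ℝ) :
    HasDerivAt (fun y => φ (x, y)) (fderiv ℝ φ (x, y) (0, 1)) y :=
  (h.differentiable (by simp) (x, y)).hasFDerivAt.comp_hasDerivAt y
    ((hasDerivAt_const y x).prodMk (hasDerivAt_id y))

/-- A transverse inequality for the pairs `f = φ(x, ·)`, `g = φ(-x, ·)`, whose coupling term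
`η (f - g) ^ 2` can be paid for by the longitudinal inequality, gives a lower bound of the form on
test functions. The points `c` and `d` stand for the Dirichlet ends of the sections `x > 0`
and `x < 0`. -/
lemma form_lower_bound_of_transverse {a : ℝ} (ha : 0 < a) {A lam η C c d : ℝ} (hA : 0 ≤ A)
    (hη : A * η ≤ 3 / 32)
    (htr : ∀ f f' g g' : ℝ → ℝ, (∀ x, HasDerivAt f (f' x) x) → Continuous f' →
      (∀ x, HasDerivAt g (g' x) x) → Continuous g' →
      0 ≤ (∫ x in (-a)..a, (f' x ^ 2 + g' x ^ 2 - lam * (f x ^ 2 + g x ^ 2)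
        + η * (f x - g x) ^ 2)) + C * (f c ^ 2 + g d ^ 2))
    {φ : ℝ × ℝ → ℝ} (hs : ContDiff ℝ ∞ φ) (hc : HasCompactSupport φ) :
    0 ≤ normSq a (fun y => fderiv ℝ φ y (1, 0)) + A * normSq a (fun y => fderiv ℝ φ y (0, 1))
      - (A * lam + 1 / 2) * normSq a φ + A * C * (halfLineSq 1 c φ + halfLineSq (-1) d φ) := by
  have kφ := hs.continuous
  have k1 := continuous_fderiv_dir hs (1, 0)
  have k2 := continuous_fderiv_dir hs (0, 1)
  have c1 := hasCompactSupport_fderiv_dir hc (1, 0)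
  have c2 := hasCompactSupport_fderiv_dir hc (0, 1)
  set p : ℝ × ℝ → ℝ := fun y => fderiv ℝ φ y (1, 0) with hp
  set q : ℝ × ℝ → ℝ := fun y => fderiv ℝ φ y (0, 1) with hq
  have kw := continuous_weight
  have int : ∀ h : ℝ × ℝ → ℝ, Continuous h → HasCompactSupport h →
      Integrable fun z : ℝ × ℝ => weight z * (h z ^ 2 + h (-z.1, z.2) ^ 2) := fun h hh hhc => by
    refine Continuous.integrable_of_hasCompactSupport (by fun_prop) ?_
    simp only [pow_two]
    exact HasCompactSupport.mul_left (hhc.mul_left.add (hasCompactSupport_reflect hhc).mul_left)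
  have i0 := int φ kφ hc
  have i1 := int p k1 c1
  have i2 := int q k2 c2
  have i3 : Integrable fun z : ℝ × ℝ => weight z * (φ z - φ (-z.1, z.2)) ^ 2 := by
    refine Continuous.integrable_of_hasCompactSupport (by fun_prop) ?_
    simp only [pow_two]
    exact HasCompactSupport.mul_left ((hc.sub (hasCompactSupport_reflect hc)).mul_left)
  have h1 := halfStrip_nonneg_of_longitudinal (a := a)
    ((i1.sub (i0.const_mul (1 / 2))).sub (i3.const_mul (3 / 32))) fun y => by
      refine (longitudinal_ineq (fun x => hasDerivAt_horizontal hs x y)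
        (k1.comp (by fun_prop)) (hasCompactSupport_horizontal hc y)).trans_eq
        (integral_congr_ae (Eventually.of_forall fun x => ?_))
      simp only [hp, weight, Pi.sub_apply]; ring
  have b1 : Integrable fun x : ℝ => Real.exp (x ^ 2 / 4) * φ (1 * x, c) ^ 2 := by
    simp only [one_mul]
    refine Continuous.integrable_of_hasCompactSupport (by fun_prop) ?_
    simp only [pow_two]
    exact (hasCompactSupport_horizontal hc c).mul_left.mul_left
  have b2 : Integrable fun x : ℝ => Real.exp (x ^ 2 / 4) * φ (-1 * x, d) ^ 2 := by
    simp only [neg_mul, one_mul]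
    refine Continuous.integrable_of_hasCompactSupport (by fun_prop) ?_
    simp only [pow_two]
    exact (hasCompactSupport_horizontal (hasCompactSupport_reflect hc) d).mul_left.mul_left
  have h2 := halfStrip_nonneg_of_transverse ha
    ((i2.sub (i0.const_mul lam)).add (i3.const_mul η)) ((b1.add b2).const_mul C) fun x => by
      have := mul_nonneg (Real.exp_pos (x ^ 2 / 4)).le
        (htr (fun y => φ (x, y)) (fun y => q (x, y)) (fun y => φ (-x, y)) (fun y => q (-x, y))
          (fun y => hasDerivAt_vertical hs x y) (by fun_prop)
          (fun y => hasDerivAt_vertical hs (-x) y) (by fun_prop))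
      rw [mul_add, ← intervalIntegral.integral_const_mul] at this
      refine this.trans_eq (congrArg₂ _ (intervalIntegral.integral_congr fun y _ => ?_) ?_)
      · simp only [weight, Pi.sub_apply, Pi.add_apply]; ring
      · simp only [Pi.add_apply, one_mul, neg_mul]; ring
  have h3 : 0 ≤ ∫ z in halfStrip a, weight z * (φ z - φ (-z.1, z.2)) ^ 2 :=
    integral_nonneg fun z => mul_nonneg (weight_pos z).le (sq_nonneg _)
  rw [integral_sub' (i1.sub (i0.const_mul _)).integrableOn (i3.const_mul _).integrableOn,
    integral_sub' i1.integrableOn (i0.const_mul _).integrableOn, integral_const_mul,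
    integral_const_mul] at h1
  rw [integral_add' (i2.sub (i0.const_mul _)).integrableOn (i3.const_mul _).integrableOn,
    integral_sub' i2.integrableOn (i0.const_mul _).integrableOn, integral_const_mul,
    integral_const_mul, integral_const_mul, integral_add' b1.integrableOn b2.integrableOn] at h2
  rw [normSq_eq k1 c1, normSq_eq k2 c2, normSq_eq kφ hc, halfLineSq, halfLineSq]
  have h4 := mul_nonneg (sub_nonneg.2 hη) h3
  have h5 := mul_nonneg hA h2
  linarith

/-- The lower bound of the form on test functions for the untwisted strip. -/
lemma form_lower_bound_zero {a k : ℝ} (ha : 0 < a) (hk : 0 < k) (hak : 2 * a * k < Real.pi / 2)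
    (s : ℝ) : ∃ C : ℝ, ∀ φ : ℝ × ℝ → ℝ, ContDiff ℝ ∞ φ → HasCompactSupport φ →
    0 ≤ normSq a (fun y => fderiv ℝ φ y (1, 0))
      + Real.exp s * normSq a (fun y => fderiv ℝ φ y (0, 1))
      - (Real.exp s * k ^ 2 + 1 / 2) * normSq a φ
      + C * (halfLineSq 1 (-a) φ + halfLineSq (-1) (-a) φ) := by
  refine ⟨_, fun φ hs hc => form_lower_bound_of_transverse ha (Real.exp_pos s).le (η := 0)
    (C := k * Real.tan (k * (2 * a))) (by norm_num) (fun f f' g g' hf hf' hg hg' => ?_) hs hc⟩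
  have h1 := transverse_ineq ha hk hak hf hf'
  have h2 := transverse_ineq ha hk hak hg hg'
  have hfc : Continuous f := continuous_iff_continuousAt.2 fun x => (hf x).continuousAt
  have hgc : Continuous g := continuous_iff_continuousAt.2 fun x => (hg x).continuousAt
  have h3 := add_nonneg h1 h2
  rw [add_add_add_comm, ← intervalIntegral.integral_add
    (Continuous.intervalIntegrable (by fun_prop) _ _)
    (Continuous.intervalIntegrable (by fun_prop) _ _), ← mul_add] at h3
  refine h3.trans_eq (congrArg (· + _) (intervalIntegral.integral_congr fun y _ => ?_))
  ring

/-- The improved lower bound of the form on test functions for the twisted strip. -/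
lemma form_lower_bound_pi {a : ℝ} (ha : 0 < a) (s : ℝ) :
    ∃ δ C : ℝ, 0 < δ ∧ ∀ φ : ℝ × ℝ → ℝ, ContDiff ℝ ∞ φ → HasCompactSupport φ →
    0 ≤ normSq a (fun y => fderiv ℝ φ y (1, 0))
      + Real.exp s * normSq a (fun y => fderiv ℝ φ y (0, 1))
      - (Real.exp s * E1 a + 1 / 2 + δ) * normSq a φ
      + C * (halfLineSq 1 a φ + halfLineSq (-1) (-a) φ) := by
  have he := Real.exp_pos s
  obtain ⟨δ, C, hδ, h⟩ := exists_transverse_pair_ineq ha (η := 3 / 32 / Real.exp s) (by positivity)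
  refine ⟨Real.exp s * δ, Real.exp s * C, by positivity, fun φ hs hc => ?_⟩
  have := form_lower_bound_of_transverse ha he.le (by rw [mul_div_cancel₀ _ he.ne']) h hs hc
  linarith

/-! ### Lower bounds of the form on its domain -/

lemma norm_sq_toLp {a : ℝ} {h : ℝ × ℝ → ℝ} (hm : MemLp h 2 (weightedMeasure a)) :
    ‖hm.toLp h‖ ^ 2 = normSq a h := by
  rw [← real_inner_self_eq_norm_sq, inner_eq, normSq]
  refine integral_congr_ae ?_
  filter_upwards [ae_restrict hm.coeFn_toLp] with y hy
  rw [hy]; ring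

lemma tendsto_normSq {a : ℝ} {h : ℕ → ℝ × ℝ → ℝ} {u : L2K a}
    (hm : ∀ n, MemLp (h n) 2 (weightedMeasure a)) (hu : TendstoL2 (weightedMeasure a) h u) :
    Tendsto (fun n => normSq a (h n)) atTop (𝓝 (‖u‖ ^ 2)) := by
  have : Tendsto (fun n => (hm n).toLp (h n)) atTop (𝓝 u) := by
    rw [← Lp.toLp_coeFn u (Lp.memLp u), Lp.tendsto_Lp_iff_tendsto_eLpNorm'']
    exact hu
  simpa only [norm_sq_toLp] using this.norm.pow 2

/-- The boundary measure dominates the line integral over a half-line in the boundary. -/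
lemma ofReal_halfLineSq_le {a σ c : ℝ} {Γ : Set (ℝ × ℝ)} (hΓ : MeasurableSet Γ)
    (hσ : σ = 1 ∨ σ = -1) (hca : c = a ∨ c = -a) (h : ∀ x, 0 < x → (σ * x, c) ∈ Γ)
    {φ : ℝ × ℝ → ℝ} (hφ : Continuous φ) (hc : HasCompactSupport φ) :
    ENNReal.ofReal (halfLineSq σ c φ) ≤ eLpNorm φ 2 ((bdryMeasure a).restrict Γ) ^ 2 := by
  have hσ2 : σ ^ 2 = 1 := by rcases hσ with rfl | rfl <;> norm_num
  set G : ℝ × ℝ → ℝ≥0∞ := fun y => ENNReal.ofReal (weight y) * ‖φ y‖ₑ ^ 2 with hG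
  have hw : Measurable fun y => ENNReal.ofReal (weight y) :=
    continuous_weight.measurable.ennreal_ofReal
  have hn : Measurable fun y => ‖φ y‖ₑ ^ 2 := hφ.measurable.enorm.pow_const 2
  set ι : ℝ → ℝ × ℝ := fun x => (σ * x, c) with hι
  have hιm : Measurable ι := by fun_prop
  have hmap : Measure.map ι volume = Measure.map (fun x : ℝ => (x, c)) volume := by
    rcases hσ with rfl | rfl
    · simp [hι]
    · have := Measure.map_map (μ := volume) (g := fun x : ℝ => (x, c)) (f := fun x : ℝ => -x)
        (by fun_prop) (by fun_prop)
      rw [show (fun x : ℝ => -x) = Neg.neg from rfl, Measure.map_neg_eq_self] at this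
      rw [this]
      congr 1
      ext x <;> simp [hι]
  have hle : Measure.map ι volume ≤ Measure.map (fun x : ℝ => (x, -a)) volume
      + Measure.map (fun x : ℝ => (x, a)) volume := by
    rw [hmap]
    rcases hca with rfl | rfl
    · exact Measure.le_add_left le_rfl
    · exact Measure.le_add_right le_rfl
  have hint : Integrable fun x : ℝ => Real.exp (x ^ 2 / 4) * φ (σ * x, c) ^ 2 := by
    refine Continuous.integrable_of_hasCompactSupport (by fun_prop) ?_
    have : HasCompactSupport fun x : ℝ => φ (σ * x, c) := by
      rcases hσ with rfl | rfl
      · simpa using hasCompactSupport_horizontal hc c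
      · simpa using hasCompactSupport_horizontal (hasCompactSupport_reflect hc) c
    simp only [pow_two]
    exact this.mul_left.mul_left
  calc ENNReal.ofReal (halfLineSq σ c φ)
      = ∫⁻ x in Set.Ioi 0, G (ι x) := by
        rw [halfLineSq, ofReal_integral_eq_lintegral_ofReal hint.integrableOn
          (Eventually.of_forall fun x => by positivity)]
        refine lintegral_congr fun x => ?_
        simp only [hG, hι, weight]
        rw [ENNReal.ofReal_mul (Real.exp_pos _).le, mul_pow, hσ2, one_mul,
          Real.enorm_eq_ofReal_abs, ← ENNReal.ofReal_pow (abs_nonneg _), sq_abs]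
    _ ≤ ∫⁻ x in ι ⁻¹' Γ, G (ι x) := lintegral_mono_set fun x hx => h x hx
    _ = ∫⁻ y in Γ, G y ∂Measure.map ι volume := (setLIntegral_map hΓ (hw.mul hn) hιm).symm
    _ ≤ ∫⁻ y in Γ, G y ∂(Measure.map (fun x : ℝ => (x, -a)) volume
          + Measure.map (fun x : ℝ => (x, a)) volume) :=
        lintegral_mono' (Measure.restrict_mono le_rfl hle) le_rfl
    _ = ∫⁻ y in Γ, ‖φ y‖ₑ ^ 2 ∂bdryMeasure a := by
        rw [bdryMeasure, setLIntegral_withDensity_eq_setLIntegral_mul _ hw hn hΓ]; rfl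
    _ = eLpNorm φ 2 ((bdryMeasure a).restrict Γ) ^ 2 := by
        rw [eLpNorm_eq_lintegral_rpow_enorm_toReal (by norm_num) (by norm_num),
          ← ENNReal.rpow_natCast, ← ENNReal.rpow_mul]
        simp

lemma tendsto_halfLineSq {a σ c : ℝ} {Γ : Set (ℝ × ℝ)} (hΓ : MeasurableSet Γ)
    (hσ : σ = 1 ∨ σ = -1) (hca : c = a ∨ c = -a) (h : ∀ x, 0 < x → (σ * x, c) ∈ Γ)
    {φ : ℕ → ℝ × ℝ → ℝ} (hφ : ∀ n, ContDiff ℝ ∞ (φ n) ∧ HasCompactSupport (φ n))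
    (ht : TendstoL2 ((bdryMeasure a).restrict Γ) φ fun _ => 0) :
    Tendsto (fun n => halfLineSq σ c (φ n)) atTop (𝓝 0) := by
  have h0 : Tendsto (fun n => eLpNorm (φ n) 2 ((bdryMeasure a).restrict Γ) ^ 2) atTop (𝓝 0) := by
    have := ENNReal.Tendsto.pow (n := 2) ht
    simpa using this
  have h1 : Tendsto (fun n => ENNReal.ofReal (halfLineSq σ c (φ n))) atTop (𝓝 0) :=
    tendsto_of_tendsto_of_tendsto_of_le_of_le tendsto_const_nhds h0 (fun _ => zero_le)
      fun n => ofReal_halfLineSq_le hΓ hσ hca h (hφ n).1.continuous (hφ n).2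
  have h2 := (ENNReal.tendsto_toReal ENNReal.zero_ne_top).comp h1
  refine h2.congr fun n => ENNReal.toReal_ofReal (integral_nonneg fun x => ?_)
  positivity

/-- A lower bound on test functions, with an error term on the Dirichlet part of the boundary,
passes to the form domain, where the error term disappears. -/
lemma form_lower_bound_of_test {a : ℝ} {θ : Theta} {A B C c d : ℝ}
    (hca : c = a ∨ c = -a) (hda : d = a ∨ d = -a)
    (hc : ∀ x, 0 < x → (x, c) ∈ dirichletBdry a θ) (hd : ∀ x, 0 < x → (-x, d) ∈ dirichletBdry a θ)
    (h : ∀ φ : ℝ × ℝ → ℝ, ContDiff ℝ ∞ φ → HasCompactSupport φ →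
      0 ≤ normSq a (fun y => fderiv ℝ φ y (1, 0)) + A * normSq a (fun y => fderiv ℝ φ y (0, 1))
        - B * normSq a φ + C * (halfLineSq 1 c φ + halfLineSq (-1) d φ))
    {U : L2K a × L2K a × L2K a} (hU : U ∈ formDomain a θ) :
    0 ≤ ‖U.2.1‖ ^ 2 + A * ‖U.2.2‖ ^ 2 - B * ‖U.1‖ ^ 2 := by
  obtain ⟨-, -, -, φ, hφ, t0, t1, t2, t3⟩ := hU
  have hm := measurableSet_dirichletBdry a θ
  have l0 := tendsto_normSq (fun n => memLp_weighted a (hφ n).1.continuous (hφ n).2) t0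
  have l1 := tendsto_normSq (fun n => memLp_weighted a (continuous_fderiv_dir (hφ n).1 (1, 0))
    (hasCompactSupport_fderiv_dir (hφ n).2 (1, 0))) t1
  have l2 := tendsto_normSq (fun n => memLp_weighted a (continuous_fderiv_dir (hφ n).1 (0, 1))
    (hasCompactSupport_fderiv_dir (hφ n).2 (0, 1))) t2
  have b1 := tendsto_halfLineSq hm (Or.inl rfl) hca (by simpa using hc) hφ t3
  have b2 := tendsto_halfLineSq hm (Or.inr rfl) hda (by simpa using hd) hφ t3
  have := ge_of_tendsto' (((l1.add (l2.const_mul A)).sub (l0.const_mul B)).add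
    ((b1.add b2).const_mul C)) fun n => h (φ n) (hφ n).1 (hφ n).2
  simpa using this

lemma form_self (a s : ℝ) (U : L2K a × L2K a × L2K a) :
    form a s U U = ‖U.2.1‖ ^ 2 + Real.exp s * ‖U.2.2‖ ^ 2
      - (E1 a * Real.exp s + 1 / 4) * ‖U.1‖ ^ 2 := by
  simp only [form, real_inner_self_eq_norm_sq]; ring

theorem form_zero_lower_bound {a : ℝ} (ha : 0 < a) (s : ℝ) {U : L2K a × L2K a × L2K a}
    (hU : U ∈ formDomain a .zero) : 1 / 4 * ‖U.1‖ ^ 2 ≤ form a s U U := by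
  -- the bound with `k ^ 2 < E₁` in place of `E₁`, and then the limit `k → π / (4 a)`
  have hk : ∀ k ∈ Set.Ioo 0 (Real.pi / (4 * a)),
      0 ≤ ‖U.2.1‖ ^ 2 + Real.exp s * ‖U.2.2‖ ^ 2 - (Real.exp s * k ^ 2 + 1 / 2) * ‖U.1‖ ^ 2 := by
    intro k hk
    have hak : 2 * a * k < Real.pi / 2 := by
      have := (lt_div_iff₀ (by positivity)).1 hk.2
      linarith
    obtain ⟨C, hC⟩ := form_lower_bound_zero ha hk.1 hak s
    exact form_lower_bound_of_test (θ := .zero) (Or.inr rfl) (Or.inr rfl)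
      (fun x _ => by simp [dirichletBdry]) (fun x _ => by simp [dirichletBdry]) hC hU
  have hlim : 0 ≤ ‖U.2.1‖ ^ 2 + Real.exp s * ‖U.2.2‖ ^ 2
      - (Real.exp s * (Real.pi / (4 * a)) ^ 2 + 1 / 2) * ‖U.1‖ ^ 2 := by
    have hpos : 0 < Real.pi / (4 * a) := by positivity
    have ht := ((by fun_prop : Continuous fun k : ℝ => ‖U.2.1‖ ^ 2 + Real.exp s * ‖U.2.2‖ ^ 2
      - (Real.exp s * k ^ 2 + 1 / 2) * ‖U.1‖ ^ 2).tendsto (Real.pi / (4 * a))).mono_left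
        (nhdsWithin_le_nhds (s := Set.Iio (Real.pi / (4 * a))))
    exact ge_of_tendsto ht (Filter.mem_of_superset (Ioo_mem_nhdsLT hpos) hk)
  rw [form_self, E1]
  linarith

theorem form_pi_lower_bound {a : ℝ} (ha : 0 < a) (s : ℝ) :
    ∃ δ > 0, ∀ U ∈ formDomain a .pi, (1 / 4 + δ) * ‖U.1‖ ^ 2 ≤ form a s U U := by
  obtain ⟨δ, C, hδ, hC⟩ := form_lower_bound_pi ha s
  refine ⟨δ, hδ, fun U hU => ?_⟩
  have := form_lower_bound_of_test (θ := .pi) (Or.inl rfl) (Or.inr rfl)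
    (fun x hx => by simp [dirichletBdry, hx]) (fun x hx => by simp [dirichletBdry, hx]) hC hU
  rw [form_self]
  linarith

/-! ### Trial functions -/

/-- Test functions that do not vanish near the Neumann part of the boundary belong to the form
domain as well. -/
lemma mem_formDomain_of_contDiff (a : ℝ) (θ : Theta) {φ : ℝ × ℝ → ℝ} (h : ContDiff ℝ ∞ φ)
    (hc : HasCompactSupport φ) (h0 : ∀ y ∈ dirichletBdry a θ, φ y = 0) :
    ((memLp_weighted a h.continuous hc).toLp φ,
      (memLp_weighted a (continuous_fderiv_dir h (1, 0))
        (hasCompactSupport_fderiv_dir hc (1, 0))).toLp _,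
      (memLp_weighted a (continuous_fderiv_dir h (0, 1))
        (hasCompactSupport_fderiv_dir hc (0, 1))).toLp _) ∈ formDomain a θ := by
  have d : ∀ e, IsWeakDeriv a e φ (fun y => fderiv ℝ φ y e) := by
    intro e ψ g gc gs
    rw [setIntegral_eq_integral_of_forall_compl_eq_zero,
      setIntegral_eq_integral_of_forall_compl_eq_zero]
    · refine integral_mul_fderiv_eq_neg_fderiv_mul_of_integrable ?_ ?_ ?_
        (fun y _ => h.differentiable (by simp) y) (fun y _ => g.differentiable (by simp) y)
      · exact ((continuous_fderiv_dir h e).mul g.continuous).integrable_of_hasCompactSupport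
          gc.mul_left
      · exact (h.continuous.mul (continuous_fderiv_dir g e)).integrable_of_hasCompactSupport
          hc.mul_right
      · exact (h.continuous.mul g.continuous).integrable_of_hasCompactSupport hc.mul_right
    · intro y hy
      rw [image_eq_zero_of_notMem_tsupport fun k => hy (gs k), mul_zero]
    · intro y hy
      have hy' : y ∉ tsupport (fderiv ℝ ψ) := fun k => hy (gs (tsupport_fderiv_subset ℝ k))
      rw [image_eq_zero_of_notMem_tsupport hy', zero_apply, mul_zero]
  have z : ∀ {f : ℝ × ℝ → ℝ} (hf : MemLp f 2 (weightedMeasure a)),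
      TendstoL2 (weightedMeasure a) (fun _ => f) (hf.toLp f) := fun {f} hf =>
    TendstoL2.congr (g := f) (by simp [TendstoL2]) hf.coeFn_toLp.symm
  have m0 := memLp_weighted a h.continuous hc
  have m1 := fun e => memLp_weighted a (continuous_fderiv_dir h e)
    (hasCompactSupport_fderiv_dir hc e)
  refine ⟨(d _).congr m0.coeFn_toLp.symm (m1 _).coeFn_toLp.symm,
    (d _).congr m0.coeFn_toLp.symm (m1 _).coeFn_toLp.symm,
    MemLp.zero, fun _ => φ, fun _ => ⟨h, hc⟩, z m0, z (m1 _), z (m1 _), ?_⟩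
  have e : (fun y => φ y - 0) =ᵐ[(bdryMeasure a).restrict (dirichletBdry a θ)] 0 :=
    (ae_restrict_iff' (measurableSet_dirichletBdry a θ)).2
      (Eventually.of_forall fun y hy => by simp [h0 y hy])
  unfold TendstoL2
  simp only [eLpNorm_congr_ae e, eLpNorm_zero]
  exact tendsto_const_nhds

/-- A smooth function with compact support that is `1` on `[-r, r]`. -/
def plateau (r : ℝ) (hr : 0 < r) : ContDiffBump (0 : ℝ) := ⟨r, r + 1, hr, by linarith⟩

lemma plateau_eq_one {r : ℝ} (hr : 0 < r) {x : ℝ} (hx : |x| ≤ r) : plateau r hr x = 1 :=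
  (plateau r hr).one_of_mem_closedBall (by simpa [plateau] using hx)

/-- With `A = exp (-x ^ 2 / 4) χ`, the longitudinal form is `∫ exp (-x ^ 2 / 4) χ' ^ 2`. -/
lemma integral_gaussian_trial {χ χ' : ℝ → ℝ} (hχ : ∀ x, HasDerivAt χ (χ' x) x)
    (hχ' : Continuous χ') (hs : HasCompactSupport χ) :
    ∫ x, Real.exp (x ^ 2 / 4) * (Real.exp (-x ^ 2 / 4) * (χ' x - x / 2 * χ x)) ^ 2
      = 1 / 2 * (∫ x, Real.exp (x ^ 2 / 4) * (Real.exp (-x ^ 2 / 4) * χ x) ^ 2)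
        + ∫ x, Real.exp (-x ^ 2 / 4) * χ' x ^ 2 := by
  have hc : Continuous χ := continuous_iff_continuousAt.2 fun x => (hχ x).continuousAt
  have hs' : HasCompactSupport χ' := by
    rw [show χ' = deriv χ from funext fun x => (hχ x).deriv.symm]; exact hs.deriv
  have hexp : ∀ x : ℝ, HasDerivAt (fun x => Real.exp (-x ^ 2 / 4))
      (Real.exp (-x ^ 2 / 4) * (-x / 2)) x := fun x => by
    have := ((hasDerivAt_pow 2 x).neg.div_const 4).exp
    exact this.congr_deriv (by norm_num; ring)
  have hd : ∀ x, HasDerivAt (fun x => -x / 2 * Real.exp (-x ^ 2 / 4) * χ x ^ 2)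
      (Real.exp (-x ^ 2 / 4) * (-(x * χ x * χ' x) + x ^ 2 / 4 * χ x ^ 2 - 1 / 2 * χ x ^ 2)) x :=
    fun x => (((hasDerivAt_neg x).div_const 2).mul (hexp x)).mul ((hχ x).pow 2)
      |>.congr_deriv (by simp; ring)
  have hz := integral_eq_zero_of_hasDerivAt_of_integrable hd
    (Continuous.integrable_of_hasCompactSupport (by fun_prop)
      (HasCompactSupport.intro hs.isCompact fun x hx => by
        simp [image_eq_zero_of_notMem_tsupport hx]))
    (Continuous.integrable_of_hasCompactSupport (by fun_prop) (by
      simp only [pow_two]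
      exact hs.mul_left.mul_left))
  have i1 : Integrable fun x => Real.exp (x ^ 2 / 4) * (Real.exp (-x ^ 2 / 4) * χ x) ^ 2 :=
    Continuous.integrable_of_hasCompactSupport (by fun_prop) (by
      simp only [pow_two]
      exact hs.mul_left.mul_left.mul_left)
  have i2 : Integrable fun x => Real.exp (-x ^ 2 / 4) * χ' x ^ 2 :=
    Continuous.integrable_of_hasCompactSupport (by fun_prop) (by
      simp only [pow_two]
      exact hs'.mul_left.mul_left)
  have i3 : Integrable fun x =>
      Real.exp (x ^ 2 / 4) * (Real.exp (-x ^ 2 / 4) * (χ' x - x / 2 * χ x)) ^ 2 :=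
    Continuous.integrable_of_hasCompactSupport (by fun_prop) (by
      simp only [pow_two]
      exact ((hs'.sub hs.mul_left).mul_left).mul_left.mul_left)
  rw [← integral_const_mul, ← integral_add (i1.const_mul _) i2, ← sub_eq_zero]
  refine (integral_sub i3 ((i1.const_mul _).add i2)).symm.trans
    (Eq.trans (integral_congr_ae (Eventually.of_forall fun x => ?_)) hz)
  simp only [Pi.add_apply]
  have hE : Real.exp (x ^ 2 / 4) * Real.exp (-x ^ 2 / 4) = 1 := by
    rw [← Real.exp_add, neg_div, add_neg_cancel, Real.exp_zero]
  linear_combination ((χ' x - x / 2 * χ x) ^ 2 - 1 / 2 * χ x ^ 2) * Real.exp (-x ^ 2 / 4) * hE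

/-- Cutting off `exp (-x ^ 2 / 4)` further and further out makes the longitudinal Rayleigh
quotient converge to `1/2`. -/
lemma exists_longitudinal_trial {ε : ℝ} (hε : 0 < ε) :
    ∃ f f' : ℝ → ℝ, ContDiff ℝ ∞ f ∧ HasCompactSupport f ∧ (∀ x, HasDerivAt f (f' x) x) ∧
      ∫ x, Real.exp (x ^ 2 / 4) * f' x ^ 2 < (1 / 2 + ε) * ∫ x, Real.exp (x ^ 2 / 4) * f x ^ 2 := by
  set b := plateau 1 one_pos with hb
  have hbs : ContDiff ℝ ∞ b := b.contDiff
  have hbc : HasCompactSupport b := b.hasCompactSupport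
  have hdb : Continuous (deriv b) := hbs.continuous_deriv (by simp)
  obtain ⟨M, hM⟩ := hdb.bounded_above_of_compact_support hbc.deriv
  have hgauss : Integrable fun x : ℝ => Real.exp (-x ^ 2 / 4) := by
    refine (integrable_exp_neg_mul_sq (b := 1 / 4) (by norm_num)).congr
      (Eventually.of_forall fun x => ?_)
    simp only; congr 1; ring
  set G := ∫ x : ℝ, Real.exp (-x ^ 2 / 4) with hG
  set c := ∫ x in (-1 : ℝ)..1, Real.exp (-x ^ 2 / 4) with hcdef
  have hc0 : 0 < c := intervalIntegral.intervalIntegral_pos_of_pos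
    (Continuous.intervalIntegrable (by fun_prop) _ _) (fun x => Real.exp_pos _) (by norm_num)
  obtain ⟨t, ⟨ht, ht1⟩, ht0⟩ : ∃ t : ℝ, ((t * M) ^ 2 * G < ε * c ∧ t < 1) ∧ 0 < t := by
    have h1 : ∀ᶠ t : ℝ in 𝓝[>] 0, (t * M) ^ 2 * G < ε * c ∧ t < 1 := nhdsWithin_le_nhds
      ((ContinuousAt.eventually_lt (by fun_prop) (by fun_prop) (by simp; positivity)).and
        (eventually_lt_nhds one_pos))
    exact (h1.and self_mem_nhdsWithin).exists
  set χ : ℝ → ℝ := fun x => b (t * x) with hχ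
  have hχs : ContDiff ℝ ∞ χ := hbs.comp (contDiff_const.mul contDiff_id)
  have hχc : HasCompactSupport χ := hbc.comp_homeomorph (Homeomorph.mulLeft₀ t ht0.ne')
  have hχd : ∀ x, HasDerivAt χ (deriv b (t * x) * t) x := fun x => by
    refine HasDerivAt.comp x (h := fun x => t * x)
      (hbs.differentiable (by simp) (t * x)).hasDerivAt ?_
    simpa using (hasDerivAt_id x).const_mul t
  have hexp : ∀ x : ℝ, HasDerivAt (fun x => Real.exp (-x ^ 2 / 4))
      (Real.exp (-x ^ 2 / 4) * (-x / 2)) x := fun x => by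
    have := ((hasDerivAt_pow 2 x).neg.div_const 4).exp
    exact this.congr_deriv (by norm_num; ring)
  refine ⟨fun x => Real.exp (-x ^ 2 / 4) * χ x,
    fun x => Real.exp (-x ^ 2 / 4) * (deriv b (t * x) * t - x / 2 * χ x),
    ContDiff.mul (by fun_prop) hχs, hχc.mul_left,
    fun x => ((hexp x).mul (hχd x)).congr_deriv (by ring), ?_⟩
  rw [integral_gaussian_trial hχd (by fun_prop) hχc]
  have hup : ∫ x, Real.exp (-x ^ 2 / 4) * (deriv b (t * x) * t) ^ 2 ≤ (t * M) ^ 2 * G := by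
    rw [hG, ← integral_const_mul]
    refine integral_mono_of_nonneg (Eventually.of_forall fun x => by positivity)
      (hgauss.const_mul _) (Eventually.of_forall fun x => ?_)
    have hMx : deriv b (t * x) ^ 2 ≤ M ^ 2 := by
      rw [← sq_abs, ← Real.norm_eq_abs]
      exact pow_le_pow_left₀ (norm_nonneg _) (hM _) 2
    calc Real.exp (-x ^ 2 / 4) * (deriv b (t * x) * t) ^ 2
        = Real.exp (-x ^ 2 / 4) * t ^ 2 * deriv b (t * x) ^ 2 := by ring
      _ ≤ Real.exp (-x ^ 2 / 4) * t ^ 2 * M ^ 2 := by gcongr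
      _ = (t * M) ^ 2 * Real.exp (-x ^ 2 / 4) := by ring
  have hlow : c ≤ ∫ x, Real.exp (x ^ 2 / 4) * (Real.exp (-x ^ 2 / 4) * χ x) ^ 2 := by
    rw [hcdef, intervalIntegral.integral_of_le (by norm_num)]
    have hcont : Continuous χ := hχs.continuous
    have hi : Integrable fun x => Real.exp (x ^ 2 / 4) * (Real.exp (-x ^ 2 / 4) * χ x) ^ 2 :=
      Continuous.integrable_of_hasCompactSupport (by fun_prop) (by
        simp only [pow_two]
        exact hχc.mul_left.mul_left.mul_left)
    refine le_trans (le_of_eq ?_) (setIntegral_le_integral (s := Set.Ioc (-1) 1) hi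
      (Eventually.of_forall fun x => by positivity))
    refine setIntegral_congr_fun measurableSet_Ioc fun x hx => ?_
    have h1 : χ x = 1 := plateau_eq_one one_pos (by
      rw [abs_mul, abs_of_pos ht0]
      exact mul_le_one₀ ht1.le (abs_nonneg _) (abs_le.2 ⟨hx.1.le, hx.2⟩))
    have hE : Real.exp (x ^ 2 / 4) * Real.exp (-x ^ 2 / 4) = 1 := by
      rw [← Real.exp_add, neg_div, add_neg_cancel, Real.exp_zero]
    simp only [h1]
    linear_combination -Real.exp (-x ^ 2 / 4) * hE
  nlinarith [mul_le_mul_of_nonneg_left hlow hε.le]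

/-- Both trigonometric squares of the transverse ground state have the integral `a`. -/
lemma integral_transverse_ground_state {a : ℝ} (ha : 0 < a) :
    (∫ y in Set.Ioo (-a) a, Real.sin (Real.pi / (4 * a) * (y + a)) ^ 2) = a ∧
    (∫ y in Set.Ioo (-a) a, Real.cos (Real.pi / (4 * a) * (y + a)) ^ 2) = a := by
  set k := Real.pi / (4 * a) with hk
  have hk0 : 0 < k := by positivity
  have hd : ∀ y : ℝ, HasDerivAt
      (fun y => Real.sin (k * (y + a)) * Real.cos (k * (y + a)) / k)
      (Real.cos (k * (y + a)) ^ 2 - Real.sin (k * (y + a)) ^ 2) y := fun y => by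
    have h1 : HasDerivAt (fun y => k * (y + a)) k y := by
      simpa using ((hasDerivAt_id y).add_const a).const_mul k
    exact ((h1.sin.mul h1.cos).div_const k).congr_deriv (by field_simp; ring)
  have h0 := intervalIntegral.integral_eq_sub_of_hasDerivAt (a := -a) (b := a) (fun y _ => hd y)
    (Continuous.intervalIntegrable (by fun_prop) _ _)
  have h2 : k * (a + a) = Real.pi / 2 := by rw [hk]; field_simp; norm_num
  rw [h2, Real.cos_pi_div_two, intervalIntegral.integral_sub
    (Continuous.intervalIntegrable (by fun_prop) _ _)
    (Continuous.intervalIntegrable (by fun_prop) _ _)] at h0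
  simp only [neg_add_cancel, mul_zero, Real.sin_zero, zero_mul, zero_div, sub_zero] at h0
  have h3 : (∫ y in (-a)..a, Real.sin (k * (y + a)) ^ 2)
      + ∫ y in (-a)..a, Real.cos (k * (y + a)) ^ 2 = 2 * a := by
    rw [← intervalIntegral.integral_add (Continuous.intervalIntegrable (by fun_prop) _ _)
      (Continuous.intervalIntegrable (by fun_prop) _ _)]
    simp only [Real.sin_sq_add_cos_sq]
    simp; ring
  rw [intervalIntegral.integral_of_le (by linarith), intervalIntegral.integral_of_le (by linarith),
    integral_Ioc_eq_integral_Ioo, integral_Ioc_eq_integral_Ioo] at h0 h3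
  constructor <;> linarith

lemma normSq_mul (a : ℝ) (f g : ℝ → ℝ) :
    normSq a (fun z => f z.1 * g z.2)
      = (∫ x, Real.exp (x ^ 2 / 4) * f x ^ 2) * ∫ y in Set.Ioo (-a) a, g y ^ 2 := by
  rw [normSq, strip, ← setIntegral_univ (μ := (volume : Measure ℝ)), ← setIntegral_prod_mul,
    ← Measure.volume_eq_prod]
  refine integral_congr_ae (Eventually.of_forall fun z => ?_)
  simp only [weight]; ring

/-- The trial functions `f(x) sin (k (y + a))` show that `1/4` is the infimum of the Rayleigh
quotient of the untwisted strip. -/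
theorem exists_form_zero_lt {a : ℝ} (ha : 0 < a) (s : ℝ) {ε : ℝ} (hε : 0 < ε) :
    ∃ U ∈ formDomain a .zero, form a s U U < (1 / 4 + ε) * ‖U.1‖ ^ 2 := by
  obtain ⟨f, f', hfs, hfc, hfd, hlt⟩ := exists_longitudinal_trial hε
  set k := Real.pi / (4 * a) with hk
  set b := plateau (a + 1) (by linarith)
  have hb : ∀ y ∈ Set.Ioo (-a) a, b =ᶠ[𝓝 y] fun _ => 1 := fun y hy =>
    Filter.mem_of_superset (isOpen_Ioo.mem_nhds hy) fun y hy =>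
      plateau_eq_one _ (abs_le.2 ⟨by linarith [hy.1], by linarith [hy.2]⟩)
  set g : ℝ → ℝ := fun y => Real.sin (k * (y + a)) * b y with hg
  have hgs : ContDiff ℝ ∞ g :=
    ContDiff.mul (Real.contDiff_sin.comp (by fun_prop)) b.contDiff
  have hgd : ∀ y, HasDerivAt g (deriv g y) y := fun y =>
    (hgs.differentiable (by simp) y).hasDerivAt
  have hgc : HasCompactSupport g := b.hasCompactSupport.mul_left
  have hg1 : ∀ y ∈ Set.Ioo (-a) a, g y = Real.sin (k * (y + a)) := fun y hy => by
    simp only [hg, (hb y hy).eq_of_nhds, mul_one]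
  have hg2 : ∀ y ∈ Set.Ioo (-a) a, deriv g y = k * Real.cos (k * (y + a)) := fun y hy => by
    have h1 : HasDerivAt (fun y => k * (y + a)) k y := by
      simpa using ((hasDerivAt_id y).add_const a).const_mul k
    have : g =ᶠ[𝓝 y] fun y => Real.sin (k * (y + a)) := by
      filter_upwards [hb y hy] with z hz
      simp [hg, hz]
    rw [this.deriv_eq, h1.sin.deriv, mul_comm]
  set φ : ℝ × ℝ → ℝ := fun z => f z.1 * g z.2 with hφ
  have hφs : ContDiff ℝ ∞ φ := (hfs.comp contDiff_fst).mul (hgs.comp contDiff_snd)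
  have hφc : HasCompactSupport φ := by
    refine HasCompactSupport.intro (hfc.isCompact.prod hgc.isCompact) fun z hz => ?_
    rw [Set.mem_prod, not_and_or] at hz
    rcases hz with h | h
    · simp [hφ, image_eq_zero_of_notMem_tsupport h]
    · simp [hφ, image_eq_zero_of_notMem_tsupport h]
  have d1 : (fun z => fderiv ℝ φ z (1, 0)) = fun z => f' z.1 * g z.2 := funext fun z =>
    (hasDerivAt_horizontal hφs z.1 z.2).unique ((hfd z.1).mul_const (g z.2))
  have d2 : (fun z => fderiv ℝ φ z (0, 1)) = fun z => f z.1 * deriv g z.2 := funext fun z =>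
    (hasDerivAt_vertical hφs z.1 z.2).unique ((hgd z.2).const_mul (f z.1))
  refine ⟨_, mem_formDomain_of_contDiff a .zero hφs hφc fun y hy => ?_, ?_⟩
  · have : y.2 = -a := hy.2
    simp [hφ, hg, this]
  · rw [form_self]
    simp only [norm_sq_toLp]
    obtain ⟨j1, j2⟩ := integral_transverse_ground_state ha
    have e1 : ∫ y in Set.Ioo (-a) a, g y ^ 2 = a := by
      refine Eq.trans (setIntegral_congr_fun measurableSet_Ioo fun y hy => ?_) j1
      simp only [hg1 y hy, hk]
    have e2 : ∫ y in Set.Ioo (-a) a, deriv g y ^ 2 = k ^ 2 * a := by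
      refine Eq.trans (setIntegral_congr_fun measurableSet_Ioo fun y hy => ?_)
        ((integral_const_mul _ _).trans (congrArg (k ^ 2 * ·) j2))
      simp only [hg2 y hy, mul_pow, hk]
    rw [d1, d2, normSq_mul, normSq_mul, normSq_mul, e1, e2, E1, ← hk]
    have := mul_lt_mul_of_pos_right hlt ha
    linarith

/-! ### The lowest points of the spectra -/

lemma exists_mem_formDomain_ne_zero {a : ℝ} (ha : 0 < a) (θ : Theta) :
    ∃ U ∈ formDomain a θ, U.1 ≠ 0 := by
  set φ : ContDiffBump (0 : ℝ × ℝ) := ⟨a / 3, a / 2, by positivity, by linarith⟩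
  have hsupp : tsupport φ ⊆ strip a := by
    rw [φ.tsupport_eq]
    intro y hy
    have : |y.2| ≤ a / 2 := (norm_snd_le y).trans (by simpa using hy)
    exact ⟨trivial, by linarith [neg_abs_le y.2], by linarith [le_abs_self y.2]⟩
  refine ⟨_, test_mem_formDomain a θ φ.contDiff φ.hasCompactSupport hsupp, fun h => ?_⟩
  have h1 := (memLp_weighted a φ.continuous φ.hasCompactSupport).coeFn_toLp
  rw [show MemLp.toLp φ _ = (0 : L2K a) from h] at h1
  have h2 := ae_restrict (h1.symm.trans (Lp.coeFn_zero _ _ _))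
  have h3 := Measure.eqOn_open_of_ae_eq h2 (isOpen_strip a) φ.continuous.continuousOn
    continuousOn_const (show (0 : ℝ × ℝ) ∈ strip a from ⟨trivial, by simpa, by simpa⟩)
  rw [φ.one_of_mem_closedBall (Metric.mem_closedBall_self φ.rIn_pos.le)] at h3
  exact one_ne_zero h3

end TwistedStrip

end

theorem mainTheorem5 (a : ℝ) (ha : 0 < a) (s : ℝ) (hs : 0 ≤ s) :
    (∀ θ : TwistedStrip.Theta,
      IsLeast (TwistedStrip.spec (TwistedStrip.op a θ s)) (TwistedStrip.mu a θ s)) ∧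
    TwistedStrip.mu a .zero s = 1 / 4 ∧
    1 / 4 < TwistedStrip.mu a .pi s := by
  open TwistedStrip in
  have hα : 0 < min 1 (Real.exp s) := lt_min one_pos (Real.exp_pos s)
  have ex := fun θ => exists_isLeast_spec (mem_graph_op_iff a θ s) (formCLM_symm a θ s) hα
    (formCLM_garding a θ s) (by
      obtain ⟨U, hU, h⟩ := exists_mem_formDomain_ne_zero ha θ
      exact ⟨formSpaceMk U hU, by rwa [formEmb_apply, tripleCoords_mk]⟩)
  have hmu : ∀ {θ m}, IsLeast (spec (op a θ s)) m → mu a θ s = m := fun h => h.csInf_eq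
  refine ⟨fun θ => ?_, hmu ?_, ?_⟩
  · obtain ⟨m, hm, -⟩ := ex θ
    rwa [hmu hm]
  · refine isLeast_spec (mem_graph_op_iff a .zero s) (formCLM_symm a .zero s) hα
      (formCLM_garding a .zero s) (fun U => ?_) fun ε hε => ?_
    · rw [formCLM_apply, formEmb_apply]
      exact form_zero_lower_bound ha s U.2
    · obtain ⟨U, hU, h⟩ := exists_form_zero_lt ha s hε
      refine ⟨formSpaceMk U hU, ?_⟩
      rwa [formCLM_apply, formEmb_apply, tripleCoords_mk]
  · obtain ⟨m, hm, hle⟩ := ex .pi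
    obtain ⟨δ, hδ, h⟩ := form_pi_lower_bound ha s
    rw [hmu hm]
    refine lt_of_lt_of_le (by linarith) (hle (1 / 4 + δ) fun U => ?_)
    rw [formCLM_apply, formEmb_apply]
    exact h _ U.2
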